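/- All Banach spaces are real, $B_{X^*}$ is the closed unit ball of $X^*$, $c_{00}$ is the space of finitely supported real sequences, and $[\mathbb N]^{\omega}$ is the set of infinite subsets of $\mathbb N$ with the topology inherited from the product topology on $2^{\mathbb N}$. A sequence $(x_i)$ in a Banach space is *normalized, weakly null* if $\|x_i\|=1$ for all $i$ and $x_i\to0$ weakly. For $\delta\in(0,1]$ and such a sequence let $K'((x_i),\delta)\in[1,\infty]$ be the infimum of all real $C$ such that $\big\|\sum_{i\in E}a_ix_i\big\|\le C\big\|\sum_i a_ix_i\big\|$ whenever $(a_i)\in c_{00}$, $E\subset\{i:|a_i|\ge\delta\}$ and $\big\|\sum_i a_ix_i\big\|\le1$. Let $$K'(\delta)=\sup_{(y_i)}\ \inf_{(z_i)\subset(y_i)}K'((z_i),\delta),$$ where the supremum is over all normalized, weakly null sequences $(y_i)$ in Banach spaces and the infimum is over all subsequences $(z_i)$ of $(y_i)$. For $\delta\in(0,1]$ put $k=\lfloor\log_2(1/\delta)\rfloor+1$, and call $\varepsilon\in(0,1)$ *admissible* for $\delta$ if $2^k\delta>1+\varepsilon$. For $c>0$, $\delta\in(0,1]$ and $\varepsilon$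 admissible for $\delta$ let $P(c,\delta,\varepsilon)$ be the following statement. Whenever $(x_i)$ is a normalized, weakly null sequence in a Banach space $X$ and $M\mapsto(\boldsymbol a_M,x^*_M,F_M)$ is a map on $[\mathbb N]^{\omega}$, with $\boldsymbol a_M=(a^M_i)\in c_{00}$, $x^*_M\in B_{X^*}$ and $F_M\subset\mathbb N$ finite, which is continuous for the discrete topology on the set of such triples, and such that 1. $(x_i)$ is a basic sequence with constant $1+\varepsilon$, i.e. $\big\|\sum_{i\le n}a_ix_i\big\|\le(1+\varepsilon)\big\|\sum_i a_ix_i\big\|$ for all $(a_i)\in c_{00}$ and all $n$; 2. $\sup_i|a_i|\le(1+\varepsilon)\big\|\sum_i a_ix_i\big\|$ for all $(a_i)\in c_{00}$; 3. for all $M\in[\mathbb N]^{\omega}$: $F_M\subset\{i\in M: a^M_i\ge\delta,\ x^*_M(x_i)>0\}$; $\|x_M\|=1$, where $x_M=\sum_{i\in M}a^M_ix_i$; and $\sum_{i\in F_M}a^M_ix^*_M(x_i)>K'(\delta)/4$; 4. $\sum_{i\notin M}|x^*_M(x_i)|<\varepsilon$ for all $M\in[\mathbb N]^{\omega}$; then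 there exist $L,M\in[\mathbb N]^{\omega}$ with $|x^*_L(x_M)|\ge c\,K'(\delta)$. **Proposition.** We have $\sup_{\delta\in(0,1]}K'(\delta)<\infty$ if and only if there is a constant $c>0$ such that $P(c,\delta,\varepsilon)$ holds for all $\delta\in(0,1]$ and all $\varepsilon$ admissible for $\delta$. Moreover, we have $\sup_{\delta\in(0,1]}K'(\delta)<\infty$ if and only if there is a constant $c>0$ such that for every $\delta\in(0,1]$ the statement $P(c,\delta,\varepsilon)$ holds for some $\varepsilon$ admissible for $\delta$. (So it does not matter how the admissible $\varepsilon$ is chosen for each $\delta$.) -/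

import Mathlib

open Filter Topology
open scoped ENNReal NNReal

noncomputable section

namespace NearUnc

universe u

/-- The finite linear combination `∑ i, a i • x i` of a finitely supported scalar sequence. -/
def comb {X : Type u} [NormedAddCommGroup X] [NormedSpace ℝ X] (x : ℕ → X) (a : ℕ →₀ ℝ) : X :=
  ∑ i ∈ a.support, a i • x i

/-- `(x i)` is a normalized, weakly null sequence. -/
structure NormalizedWeaklyNull {X : Type u} [NormedAddCommGroup X] [NormedSpace ℝ X]
    (x : ℕ → X) : Prop where
  norm_eq_one : ∀ i, ‖x i‖ = 1
  weakly_null : ∀ f : StrongDual ℝ X, Tendsto (fun i => f (x i)) atTop (𝓝 0)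

/-- `(x i)` is a basic sequence with constant `C`: the vectors are non-zero, and the projections
onto initial segments of the index set are bounded by `C`. -/
structure BasicWithConst {X : Type u} [NormedAddCommGroup X] [NormedSpace ℝ X]
    (x : ℕ → X) (C : ℝ) : Prop where
  ne_zero : ∀ i, x i ≠ 0
  proj_le : ∀ (a : ℕ →₀ ℝ) (n : ℕ), ‖∑ i ∈ Finset.range n, a i • x i‖ ≤ C * ‖comb x a‖

/-- The constant `K'((x i), δ)`: the infimum of all real `C` such that
`‖∑ i ∈ E, a i • x i‖ ≤ C * ‖∑ i, a i • x i‖` whenever `a` is finitely supported, `|a i| ≥ δ` for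
all `i ∈ E`, and `‖∑ i, a i • x i‖ ≤ 1`. It is `∞` if there is no such `C`. (Only
non-negative `C` can occur, since one may take `a` to be a unit vector and `E` its support.) -/
def kPrimeSeq {X : Type u} [NormedAddCommGroup X] [NormedSpace ℝ X]
    (x : ℕ → X) (δ : ℝ) : ℝ≥0∞ :=
  ⨅ (C : ℝ≥0) (_ : ∀ (a : ℕ →₀ ℝ) (E : Finset ℕ), (∀ i ∈ E, δ ≤ |a i|) → ‖comb x a‖ ≤ 1 →
    ‖∑ i ∈ E, a i • x i‖ ≤ C * ‖comb x a‖), (C : ℝ≥0∞)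

/-- The constant `K'(δ)`: the supremum over all normalized, weakly null sequences `(y i)` in
Banach spaces of the infimum of `K'((z i), δ)` over all subsequences `(z i)` of `(y i)`. -/
def kPrime (δ : ℝ) : ℝ≥0∞ :=
  ⨆ (X : Type u) (_ : NormedAddCommGroup X) (_ : NormedSpace ℝ X) (_ : CompleteSpace X)
    (y : ℕ → X) (_ : NormalizedWeaklyNull y),
    ⨅ (φ : ℕ → ℕ) (_ : StrictMono φ), kPrimeSeq (y ∘ φ) δ

/-- The infinite subsets of `ℕ`. -/
abbrev InfSubset : Type := {M : Set ℕ // M.Infinite}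

/-- Infinite subsets of `ℕ` carry the topology inherited from the product topology on
`{0, 1}^ℕ`, each factor being discrete. -/
instance : TopologicalSpace InfSubset :=
  TopologicalSpace.induced (fun (M : InfSubset) (i : ℕ) =>
    (Classical.propDecidable (i ∈ M.1)).decide) inferInstance

/-- The data `(a, x*, F)` of which witnesses consist. -/
@[ext]
structure WitnessData (X : Type u) [NormedAddCommGroup X] [NormedSpace ℝ X] where
  /-- the finitely supported sequence of coefficients -/
  a : ℕ →₀ ℝ
  /-- the functional `x*` -/
  f : StrongDual ℝ X
  /-- the finite set of coordinates -/
  F : Finset ℕ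

open scoped Classical in
/-- The vector `x_M = ∑ i ∈ M, a i • x i`. -/
def WitnessData.vec {X : Type u} [NormedAddCommGroup X] [NormedSpace ℝ X]
    (w : WitnessData X) (x : ℕ → X) (M : InfSubset) : X :=
  ∑ i ∈ w.a.support with i ∈ M.1, w.a i • x i

/-- `w = (a, x*, F)` is a witness for `M` (for the constant `K'(δ)` and the sequence `x`). -/
structure IsWitness {X : Type u} [NormedAddCommGroup X] [NormedSpace ℝ X]
    (δ : ℝ) (x : ℕ → X) (M : InfSubset) (w : WitnessData X) : Prop where
  norm_f_le : ‖w.f‖ ≤ 1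
  F_subset : ∀ i ∈ w.F, i ∈ M.1 ∧ δ ≤ w.a i ∧ 0 < w.f (x i)
  norm_vec : ‖w.vec x M‖ = 1
  lt_sum : kPrime.{u} δ / 4 < ENNReal.ofReal (∑ i ∈ w.F, w.a i * w.f (x i))

/-- The constraints on the auxiliary parameter `ε` for a given `δ`: with
`k = ⌊log₂ (1 / δ)⌋ + 1` one has `0 < ε < 1` and `1 + ε < 2 ^ k * δ`. -/
def Admissible (δ ε : ℝ) : Prop :=
  0 < ε ∧ ε < 1 ∧ 1 + ε < 2 ^ (⌊Real.logb 2 (1 / δ)⌋₊ + 1) * δ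

/-- The sequence `x` and the selection `M ↦ w M = (a_M, x*_M, F_M)` are as required (for
the parameters `δ` and `ε`). -/
structure IsStableSelection {X : Type u} [NormedAddCommGroup X] [NormedSpace ℝ X]
    (δ ε : ℝ) (x : ℕ → X) (w : InfSubset → WitnessData X) : Prop where
  normalizedWeaklyNull : NormalizedWeaklyNull x
  basic : BasicWithConst x (1 + ε)
  coeff_le : ∀ (a : ℕ →₀ ℝ) (i : ℕ), |a i| ≤ (1 + ε) * ‖comb x a‖
  isWitness : ∀ M, IsWitness δ x M (w M)
  /-- The selection is continuous, where the set of all witnesses has the discrete topology. -/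
  continuous : IsLocallyConstant w
  /-- `∑_{i ∉ M} |x*_M (x i)| < ε` for every infinite `M`. -/
  support_lt : ∀ M : InfSubset,
    ∑' i : {i : ℕ // i ∉ M.1}, ENNReal.ofReal |(w M).f (x i)| < ENNReal.ofReal ε

/-- For every normalized, weakly null sequence in a Banach space and every selection of witnesses
as above there are infinite `L`, `M` with `|x*_L (x_M)| ≥ c * K'(δ)`. -/
def MatchingProperty (c δ ε : ℝ) : Prop :=
  ∀ (X : Type u) [NormedAddCommGroup X] [NormedSpace ℝ X] [CompleteSpace X]
    (x : ℕ → X) (w : InfSubset → WitnessData X), IsStableSelection δ ε x w →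
    ∃ L M : InfSubset,
      ENNReal.ofReal c * kPrime.{u} δ ≤ ENNReal.ofReal |(w L).f ((w M).vec x M)|

end NearUnc

end

namespace NearUnc

universe u

/-! ### Infinite subsets of `ℕ` and their initial segments -/

/-! Boundedness from matching. Take a weakly null sequence all of whose subsequences have constant
above `K'(δ)/2`. In each infinite set `M`, normalize a vector violating the bound, norm its `E`-part
by a functional, and keep only the indices of one sign pattern. This costs a factor 2 and leaves a
sum above `K'(δ)/4`. The choice depends only on an initial segment of `M`. After thinning, the
sequence has good basis constants and the functional of `M` almost vanishes off `M`. So a stable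
selection exists, and matching gives `c K'(δ) ≤ |x*_L(x_M)| ≤ 1`.

This needs `K'(δ) < ∞` beforehand (Elton's theorem, `kPrime_lt_top`). The same selection proves it.
`exists_matching` finds `L`, `M` for which `F_L` is exactly the part of the support of `x_M` in `L`,
and lies in `F_M`. Coefficients there lie between `δ` and 2, so `x*_L(x_M) ≤ 1` bounds the witnessed
sum by a multiple of `1/δ`.

Matching from boundedness. If all `|x*_L(x_M)|` are at most `2θ`, renorm by the supremum of all
`|x*_L|` and of `θ` times the coordinate functionals. Every `x_M` becomes short, while its part over
`F_M` keeps norm above `K'(δ)/4 ≥ 1/4`. Rescaling shows `K'(δ/2) ≥ 1/(8θ)` (`le_kPrime_half`), which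
is impossible for small `θ` when `K'` is bounded.

The combinatorics is a Ramsey theory of clopen families via an ultrafilter: `large_or_large_compl`
decides each clopen family, and `exists_fusion` realizes countably many decisions on one infinite
set. Combined with Mazur's theorem, it makes locally constant functionals small off their index sets
(`exists_subseq_abs_lt`). -/

theorem mem_nhds_infSubset {M : InfSubset} {A : Set InfSubset} :
    A ∈ 𝓝 M ↔ ∃ n : ℕ, ∀ M' : InfSubset, (∀ i < n, (i ∈ M'.1 ↔ i ∈ M.1)) → M' ∈ A := by
  rw [nhds_induced, nhds_pi, Filter.mem_comap]
  constructor
  · rintro ⟨t, ht, htA⟩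
    obtain ⟨I, hI, v, hv, hsub⟩ := Filter.mem_pi.1 ht
    obtain ⟨n, hn⟩ := hI.bddAbove
    refine ⟨n + 1, fun M' h => htA (hsub fun i hi => ?_)⟩
    have := mem_of_mem_nhds (hv i)
    have hi' := h i (Nat.lt_succ_of_le (hn hi))
    have hdec : (Classical.propDecidable (i ∈ M'.1)).decide =
        (Classical.propDecidable (i ∈ M.1)).decide := by simp [hi']
    change (Classical.propDecidable (i ∈ M'.1)).decide ∈ v i
    rw [hdec]
    exact this
  · rintro ⟨n, hn⟩
    refine ⟨Set.pi (Set.Iio n) fun i => {(Classical.propDecidable (i ∈ M.1)).decide},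
      Filter.pi_mem_pi (Set.finite_Iio n) fun i _ => by simp, fun M' h => hn M' fun i hi => ?_⟩
    have := h i hi
    simpa using this

theorem isLocallyConstant_iff_infSubset {α : Type*} {g : InfSubset → α} :
    IsLocallyConstant g ↔
      ∀ M, ∃ n : ℕ, ∀ M' : InfSubset, (∀ i < n, (i ∈ M'.1 ↔ i ∈ M.1)) → g M' = g M := by
  rw [IsLocallyConstant.iff_eventually_eq]
  exact forall_congr' fun M => mem_nhds_infSubset

theorem isClopen_preimage_of_isLocallyConstant {X α : Type*} [TopologicalSpace X] {g : X → α}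
    (hg : IsLocallyConstant g) (s : Set α) : IsClopen (g ⁻¹' s) :=
  ⟨⟨hg sᶜ⟩, hg s⟩

theorem exists_agree_of_isClopen {A : Set InfSubset} (hA : IsClopen A) (M : InfSubset) :
    ∃ n : ℕ, ∀ M' : InfSubset, (∀ i < n, (i ∈ M'.1 ↔ i ∈ M.1)) → (M' ∈ A ↔ M ∈ A) := by
  by_cases hM : M ∈ A
  · obtain ⟨n, hn⟩ := mem_nhds_infSubset.1 (hA.isOpen.mem_nhds hM)
    exact ⟨n, fun M' h => iff_of_true (hn M' h) hM⟩
  · obtain ⟨n, hn⟩ := mem_nhds_infSubset.1 (hA.compl.isOpen.mem_nhds hM)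
    exact ⟨n, fun M' h => iff_of_false (hn M' h) hM⟩

/-- The finite set `s` is an initial segment of `M`. -/
def Init (s : Finset ℕ) (M : InfSubset) : Prop :=
  (∀ i ∈ s, i ∈ M.1) ∧ ∀ m ∈ M.1, m ∉ s → ∀ i ∈ s, i < m

theorem Init.of_insert {s : Finset ℕ} {m : ℕ} {M : InfSubset} (hm : ∀ i ∈ s, i < m)
    (h : Init (insert m s) M) : Init s M := by
  refine ⟨fun i hi => h.1 i (Finset.mem_insert_of_mem hi), fun k hk hks i hi => ?_⟩
  by_cases hkm : k = m
  · exact hkm ▸ hm i hi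
  · exact h.2 k hk (by simp [hkm, hks]) i (Finset.mem_insert_of_mem hi)

theorem Init.agree {s : Finset ℕ} {M M' : InfSubset} (h : Init s M) (h' : Init s M') {i₀ n : ℕ}
    (hi₀ : i₀ ∈ s) (hn : n ≤ i₀) (i : ℕ) (hi : i < n) : i ∈ M'.1 ↔ i ∈ M.1 := by
  by_cases his : i ∈ s
  · exact iff_of_true (h'.1 i his) (h.1 i his)
  · refine iff_of_false (fun hm => ?_) fun hm => ?_
    · exact absurd (h'.2 i hm his i₀ hi₀) (by omega)
    · exact absurd (h.2 i hm his i₀ hi₀) (by omega)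

theorem exists_init (s : Finset ℕ) : ∃ M : InfSubset, Init s M := by
  refine ⟨⟨↑s ∪ Set.Ioi (s.sup id), (Set.Ioi_infinite _).mono Set.subset_union_right⟩,
    fun i hi => Or.inl hi, fun m hm hms i hi => ?_⟩
  rcases hm with hm | hm
  · exact absurd hm hms
  · exact lt_of_le_of_lt (Finset.le_sup (f := id) hi) hm

open scoped Classical in
/-- The initial segment of `M` consisting of its elements below `n`. -/
noncomputable def seg (M : Set ℕ) (n : ℕ) : Finset ℕ :=
  (Finset.range n).filter (· ∈ M)

theorem mem_seg {M : Set ℕ} {n i : ℕ} : i ∈ seg M n ↔ i < n ∧ i ∈ M := by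
  simp [seg]

theorem init_seg (M : InfSubset) (n : ℕ) : Init (seg M.1 n) M := by
  refine ⟨fun i hi => (mem_seg.1 hi).2, fun m hm hms i hi => ?_⟩
  rw [mem_seg] at hms hi
  by_contra h
  exact hms ⟨by omega, hm⟩

/-! ### Largeness along an ultrafilter -/

/-- Almost all choices of elements for the ultrafilter, iterated along a well-founded tree
of finite end-extensions of `s`, force a set to lie in `A`. -/
inductive Large (A : Set InfSubset) : Finset ℕ → Prop
  | base (s : Finset ℕ) (h : ∀ M, Init s M → M ∈ A) : Large A s
  | step (s : Finset ℕ) (T : Set ℕ) (hT : T ∈ hyperfilter ℕ)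
      (h : ∀ m ∈ T, Large A (insert m s)) : Large A s

theorem eventually_hyperfilter_gt (s : Finset ℕ) : ∀ᶠ m in hyperfilter ℕ, ∀ i ∈ s, i < m := by
  refine Nat.hyperfilter_le_atTop ?_
  filter_upwards [eventually_gt_atTop (s.sup id)] with m hm i hi
  exact lt_of_le_of_lt (Finset.le_sup (f := id) hi) hm

theorem Large.of_eventually {A : Set InfSubset} {s : Finset ℕ}
    (h : ∀ᶠ m in hyperfilter ℕ, Large A (insert m s)) : Large A s :=
  .step s _ h fun _ hm => hm

theorem Large.eventually {A : Set InfSubset} {s : Finset ℕ} (h : Large A s) :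
    ∀ᶠ m in hyperfilter ℕ, Large A (insert m s) := by
  cases h with
  | base _ h =>
    filter_upwards [eventually_hyperfilter_gt s] with m hm
    exact .base _ fun M hM => h M (hM.of_insert hm)
  | step _ T hT h => exact mem_of_superset hT h

theorem Large.exists_mem {A : Set InfSubset} {s : Finset ℕ} (h : Large A s) :
    ∃ M ∈ A, Init s M := by
  induction h with
  | base s h =>
    obtain ⟨M, hM⟩ := exists_init s
    exact ⟨M, h M hM, hM⟩
  | step s T hT _ ih =>
    obtain ⟨m, hm, hmT⟩ := ((eventually_hyperfilter_gt s).and hT).exists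
    obtain ⟨M, hMA, hM⟩ := ih m hmT
    exact ⟨M, hMA, hM.of_insert hm⟩

theorem Large.mono_on {A B : Set InfSubset} {s : Finset ℕ} (h : Large A s)
    (hAB : ∀ M, Init s M → M ∈ A → M ∈ B) : Large B s := by
  induction h with
  | base s h => exact .base s fun M hM => hAB M hM (h M hM)
  | step s T hT _ ih =>
    refine .of_eventually ?_
    filter_upwards [hT, eventually_hyperfilter_gt s] with m hmT hm
    exact ih m hmT fun M hM => hAB M (hM.of_insert hm)

theorem Large.mono {A B : Set InfSubset} {s : Finset ℕ} (h : Large A s) (hAB : A ⊆ B) :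
    Large B s :=
  h.mono_on fun _ _ hM => hAB hM

/-- With `Large.mono` this gives the filter properties of largeness. Together with
`Large.exists_mem`, finitely many large sets have a common point. -/
theorem Large.inter {A B : Set InfSubset} {s : Finset ℕ} (hA : Large A s) (hB : Large B s) :
    Large (A ∩ B) s := by
  induction hA with
  | base s h => exact hB.mono_on fun M hM hMB => ⟨h M hM, hMB⟩
  | step s T hT _ ih =>
    refine .of_eventually ?_
    filter_upwards [hT, hB.eventually] with m hmT hm
    exact ih m hmT hm

theorem large_univ (s : Finset ℕ) : Large Set.univ s :=
  .base s fun _ _ => trivial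

theorem large_biInter {ι : Type*} (I : Finset ι) (A : ι → Set InfSubset) {s : Finset ℕ}
    (h : ∀ i ∈ I, Large (A i) s) : Large {M | ∀ i ∈ I, M ∈ A i} s := by
  classical
  induction I using Finset.induction_on with
  | empty => exact (large_univ s).mono fun _ _ => by simp
  | insert i I _ ih =>
    refine ((h i (by simp)).inter (ih fun j hj => h j (by simp [hj]))).mono ?_
    rintro M ⟨hM, hM'⟩ j hj
    rcases Finset.mem_insert.1 hj with rfl | hj
    exacts [hM, hM' j hj]

/-- A sequence of finite sets, each obtained from its predecessors by adding an element above
them, that is chosen inside given large sets. -/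
theorem exists_strictMono_forall_mem (T : Finset ℕ → Set ℕ) (hT : ∀ t, T t ∈ hyperfilter ℕ) :
    ∃ φ : ℕ → ℕ, StrictMono φ ∧ ∀ j, φ j ∈ T ((Finset.range j).image φ) := by
  have hex : ∀ t : Finset ℕ, ∃ m, m ∈ T t ∧ ∀ i ∈ t, i < m := fun t =>
    (Eventually.and (hT t) (eventually_hyperfilter_gt t)).exists
  choose g hgT hg using hex
  let S : ℕ → Finset ℕ := fun n => Nat.rec ∅ (fun _ t => insert (g t) t) n
  have hS : ∀ j, S j = (Finset.range j).image fun i => g (S i) := by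
    intro j
    induction j with
    | zero => rfl
    | succ j ih =>
      rw [Finset.range_add_one, Finset.image_insert, ← ih]
  refine ⟨fun j => g (S j), strictMono_nat_of_lt_succ fun j => ?_, fun j => ?_⟩
  · exact hg _ _ (Finset.mem_insert_self _ _)
  · simp only [← hS j]
    exact hgT _

/-! ### Dichotomy for clopen sets, and fusion -/

/-- An undecided finite set has undecided one-point extensions for almost all new points, since an
ultrafilter chooses between the two alternatives. Iterating gives an infinite set with arbitrarily
long undecided initial segments. But a clopen set is determined near each point by a finite initial
segment. -/
theorem large_or_large_compl {A : Set InfSubset} (hA : IsClopen A) (s : Finset ℕ) :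
    Large A s ∨ Large Aᶜ s := by
  by_contra hs
  let D : Finset ℕ → Prop := fun t => Large A t ∨ Large Aᶜ t
  have hD : ∀ t, ¬ D t → ∀ᶠ m in hyperfilter ℕ, ¬ D (insert m t) := by
    intro t ht
    rw [Ultrafilter.eventually_not]
    intro h
    refine ht ((Ultrafilter.eventually_or.1 h).imp ?_ ?_) <;> exact .of_eventually
  have hex : ∀ t : {t // ¬ D t}, ∃ m, ¬ D (insert m t.1) ∧ ∀ i ∈ t.1, i < m := fun t =>
    ((hD t.1 t.2).and (eventually_hyperfilter_gt t.1)).exists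
  choose g hgD hg using hex
  let S : ℕ → {t // ¬ D t} := fun n => Nat.rec ⟨s, hs⟩ (fun _ t => ⟨insert (g t) t.1, hgD t⟩) n
  have hSs : ∀ n, (S (n + 1)).1 = insert (g (S n)) (S n).1 := fun n => rfl
  have hg1 : StrictMono fun n => g (S n) := strictMono_nat_of_lt_succ fun n =>
    hg _ _ (by rw [hSs]; exact Finset.mem_insert_self _ _)
  have hmono : Monotone fun n => (S n).1 := monotone_nat_of_le_succ fun n => by
    rw [hSs]; exact Finset.subset_insert _ _
  let M : InfSubset := ⟨⋃ n, ↑(S n).1,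
    (Set.infinite_range_of_injective hg1.injective).mono (by
      rintro _ ⟨n, rfl⟩
      exact Set.mem_iUnion.2 ⟨n + 1, by rw [hSs]; simp⟩)⟩
  have hnew : ∀ n k, ∀ m ∈ (S (n + k)).1, m ∉ (S n).1 → ∀ i ∈ (S n).1, i < m := by
    intro n k
    induction k with
    | zero => intro m hm hm'; exact absurd hm hm'
    | succ k ih =>
      intro m hm hm' i hi
      rw [← add_assoc, hSs, Finset.mem_insert] at hm
      rcases hm with rfl | hm
      · exact hg _ i (hmono (Nat.le_add_right n k) hi)
      · exact ih m hm hm' i hi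
  have hinit : ∀ n, Init (S n).1 M := by
    refine fun n => ⟨fun i hi => Set.mem_iUnion.2 ⟨n, hi⟩, fun m hm hm' i hi => ?_⟩
    obtain ⟨k, hk⟩ := Set.mem_iUnion.1 hm
    exact hnew n k m (hmono (Nat.le_add_left k n) hk) hm' i hi
  -- The segment `S (n + 1)` contains an element at least `n`, so it already determines membership
  -- in `A`. This contradicts its being undecided.
  obtain ⟨n, hn⟩ := exists_agree_of_isClopen hA M
  have hdec : ∀ M', Init (S (n + 1)).1 M' → (M' ∈ A ↔ M ∈ A) := fun M' h =>
    hn M' ((hinit (n + 1)).agree h (i₀ := g (S n)) (by rw [hSs]; simp) hg1.le_apply)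
  refine (S (n + 1)).2 ?_
  by_cases hM : M ∈ A
  · exact Or.inl (.base _ fun M' h => (hdec M' h).2 hM)
  · exact Or.inr (.base _ fun M' h h' => hM ((hdec M' h).1 h'))

theorem seg_succ {φ : ℕ → ℕ} (hφ : StrictMono φ) {M : Set ℕ} (hM : M ⊆ Set.range φ) (k : ℕ)
    [Decidable (φ k ∈ M)] :
    seg M (φ (k + 1)) = if φ k ∈ M then insert (φ k) (seg M (φ k)) else seg M (φ k) := by
  have key : ∀ i, i ∈ M → (i < φ (k + 1) ↔ i = φ k ∨ i < φ k) := by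
    intro i hi
    obtain ⟨l, rfl⟩ := hM hi
    rw [hφ.lt_iff_lt, hφ.lt_iff_lt, hφ.injective.eq_iff]
    omega
  ext i
  split_ifs with h
  · rw [Finset.mem_insert, mem_seg, mem_seg]
    constructor
    · rintro ⟨h1, h2⟩
      exact ((key i h2).1 h1).imp id fun h => ⟨h, h2⟩
    · rintro (rfl | ⟨h1, h2⟩)
      · exact ⟨hφ k.lt_succ_self, h⟩
      · exact ⟨(key i h2).2 (Or.inr h1), h2⟩
  · rw [mem_seg, mem_seg]
    refine and_congr_left fun h2 => (key i h2).trans (or_iff_right ?_)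
    rintro rfl
    exact h h2

theorem seg_subset_image {φ : ℕ → ℕ} (hφ : StrictMono φ) {M : Set ℕ} (hM : M ⊆ Set.range φ)
    (k : ℕ) : seg M (φ k) ⊆ (Finset.range k).image φ := by
  intro i hi
  obtain ⟨h1, h2⟩ := mem_seg.1 hi
  obtain ⟨l, rfl⟩ := hM h2
  exact Finset.mem_image_of_mem _ (Finset.mem_range.2 (hφ.lt_iff_lt.1 h1))

open scoped Classical in
/-- Fusion: if for every initial segment `s` the clopen sets `P j s m b` are large for almost all
choices of a next element `m` (to be added if `b` is true, and to be skipped otherwise), then all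
infinite subsets of a suitable infinite set belong to all relevant sets `P j s m b`. -/
theorem exists_fusion (P : ℕ → Finset ℕ → ℕ → Bool → Set InfSubset)
    (hP : ∀ j s m b, IsClopen (P j s m b))
    (hlarge : ∀ j s b, ∀ᶠ m in hyperfilter ℕ, Large (P j s m b) (if b then insert m s else s)) :
    ∃ φ : ℕ → ℕ, StrictMono φ ∧ ∀ M : InfSubset, M.1 ⊆ Set.range φ →
      ∀ j, M ∈ P j (seg M.1 (φ j)) (φ j) (decide (φ j ∈ M.1)) := by
  -- Points allowed after `t`: they make the newly introduced sets large, and adding them preserves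
  -- all largeness achieved earlier. Every subset of `t` is considered, since any of them may be the
  -- initial segment of the later `M`.
  let T : Finset ℕ → Set ℕ := fun t =>
    {m | (∀ s ∈ t.powerset, ∀ b ∈ (Finset.univ : Finset Bool),
        Large (P t.card s m b) (if b then insert m s else s)) ∧
      ∀ i ∈ t, ∀ j ∈ Finset.range t.card, ∀ s₀ ∈ t.powerset, ∀ b ∈ (Finset.univ : Finset Bool),
        ∀ s ∈ t.powerset, Large (P j s₀ i b) s → Large (P j s₀ i b) (insert m s)}
  have hT : ∀ t, T t ∈ hyperfilter ℕ := by
    intro t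
    refine Filter.Eventually.and (p := fun m => ∀ s ∈ t.powerset,
      ∀ b ∈ (Finset.univ : Finset Bool), Large (P t.card s m b) (if b then insert m s else s)) ?_ ?_
    · simp only [eventually_all_finset]
      exact fun s _ b _ => hlarge _ s b
    · simp only [eventually_all_finset]
      intro i _ j _ s₀ _ b _ s _
      by_cases h : Large (P j s₀ i b) s
      · exact h.eventually.mono fun _ hm _ => hm
      · exact Eventually.of_forall fun _ h' => absurd h' h
  obtain ⟨φ, hφ, hφT⟩ := exists_strictMono_forall_mem T hT
  have hcard : ∀ j, ((Finset.range j).image φ).card = j := fun j => by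
    rw [Finset.card_image_of_injective _ hφ.injective, Finset.card_range]
  refine ⟨φ, hφ, fun M hM j => ?_⟩
  set A := P j (seg M.1 (φ j)) (φ j) (decide (φ j ∈ M.1)) with hA
  -- Skipped points leave the segment unchanged, and added ones preserve largeness by the choice of
  -- `φ`.
  have hlg : ∀ k, Large A (seg M.1 (φ (j + 1 + k))) := by
    intro k
    induction k with
    | zero =>
      have := (hφT j).1 _ (Finset.mem_powerset.2 (seg_subset_image hφ hM j))
        (decide (φ j ∈ M.1)) (Finset.mem_univ _)
      rw [hcard] at this
      rw [add_zero, seg_succ hφ hM]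
      simpa using this
    | succ k ih =>
      rw [← add_assoc, seg_succ hφ hM]
      split_ifs with h
      · refine (hφT (j + 1 + k)).2 (φ j) (Finset.mem_image_of_mem _ (by simp; omega)) j
          (by rw [hcard]; simp; omega) _ (Finset.mem_powerset.2 ?_) _ (Finset.mem_univ _) _
          (Finset.mem_powerset.2 (seg_subset_image hφ hM _)) ih
        exact (seg_subset_image hφ hM j).trans
          (Finset.image_subset_image (Finset.range_subset_range.2 (by omega)))
      · exact ih
  -- Largeness on a long segment yields only some member `M'` of `A` with that segment. Clopenness
  -- transfers membership from `M'` to `M`.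
  obtain ⟨n, hn⟩ := exists_agree_of_isClopen (hP j (seg M.1 (φ j)) (φ j) (decide (φ j ∈ M.1))) M
  obtain ⟨i₀, hi₀, hni₀⟩ := M.2.exists_gt n
  obtain ⟨M', hM'A, hM'⟩ := (hlg (i₀ + 1)).exists_mem
  refine (hn M' ((init_seg M _).agree hM' (i₀ := i₀) (mem_seg.2 ⟨?_, hi₀⟩) hni₀.le)).1 hM'A
  have := hφ.le_apply (x := j + 1 + (i₀ + 1))
  omega

variable {X : Type u} [NormedAddCommGroup X] [NormedSpace ℝ X]

/-! ### Finite linear combinations -/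

theorem comb_eq_linearCombination (x : ℕ → X) (a : ℕ →₀ ℝ) :
    comb x a = Finsupp.linearCombination ℝ x a := rfl

theorem comb_eq_sum (x : ℕ → X) {a : ℕ →₀ ℝ} {s : Finset ℕ} (h : a.support ⊆ s) :
    comb x a = ∑ i ∈ s, a i • x i :=
  Finset.sum_subset h fun i _ hi => by simp [Finsupp.notMem_support_iff.1 hi]

theorem comb_comp (x : ℕ → X) (φ : ℕ → ℕ) (a : ℕ →₀ ℝ) :
    comb (x ∘ φ) a = comb x (a.mapDomain φ) := by
  rw [comb_eq_linearCombination, comb_eq_linearCombination, Finsupp.linearCombination_mapDomain]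

theorem comb_smul (x : ℕ → X) (r : ℝ) (a : ℕ →₀ ℝ) : comb x (r • a) = r • comb x a :=
  map_smul (Finsupp.linearCombination ℝ x) r a

theorem comb_single (x : ℕ → X) (i : ℕ) (r : ℝ) : comb x (Finsupp.single i r) = r • x i :=
  Finsupp.linearCombination_single ℝ r i

theorem sum_half_pow_le (S : Finset ℕ) : ∑ j ∈ S, (1 / 2 : ℝ) ^ (j + 1) ≤ 1 := by
  have h : HasSum (fun j : ℕ => (1 / 2 : ℝ) ^ (j + 1)) 1 := by
    have := hasSum_geometric_two.mul_right (1 / 2 : ℝ)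
    simpa [pow_succ] using this
  exact sum_le_hasSum S (fun _ _ => by positivity) h

theorem sum_mul_le_of_le_half_pow {S : Finset ℕ} {a b : ℕ → ℝ} {A c : ℝ} (hc : 0 ≤ c)
    (hA : 0 ≤ A) (ha : ∀ j ∈ S, |a j| ≤ A) (hb : ∀ j ∈ S, |b j| ≤ c * (1 / 2) ^ (j + 1)) :
    |∑ j ∈ S, a j * b j| ≤ A * c := by
  calc |∑ j ∈ S, a j * b j| ≤ ∑ j ∈ S, |a j * b j| := Finset.abs_sum_le_sum_abs _ _
    _ ≤ ∑ j ∈ S, A * c * (1 / 2) ^ (j + 1) := by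
        refine Finset.sum_le_sum fun j hj => ?_
        rw [abs_mul, mul_assoc]
        exact mul_le_mul (ha j hj) (hb j hj) (abs_nonneg _) hA
    _ = A * c * ∑ j ∈ S, (1 / 2) ^ (j + 1) := by rw [Finset.mul_sum]
    _ ≤ A * c := mul_le_of_le_one_right (by positivity) (sum_half_pow_le S)

/-! ### Almost vanishing off the index set -/

/-- Otherwise, for almost all `i`, the sets `{M | η ≤ f M (x i)}` are large. Finitely many of them
have a common `M`, so every convex combination of these `x i` has norm at least `η`. Separating
their convex hull from the ball of radius `η` contradicts weak nullness. -/
theorem eventually_large_lt {x : ℕ → X}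
    (hx : ∀ g : StrongDual ℝ X, Tendsto (fun i => g (x i)) atTop (𝓝 0))
    {f : InfSubset → StrongDual ℝ X} (hf : IsLocallyConstant f) (hf1 : ∀ M, ‖f M‖ ≤ 1)
    {η : ℝ} (hη : 0 < η) (s : Finset ℕ) :
    ∀ᶠ i in hyperfilter ℕ, Large {M | f M (x i) < η} s := by
  by_contra hcon
  rw [← Ultrafilter.eventually_not] at hcon
  have hcon' : ∀ᶠ i in hyperfilter ℕ, Large {M | η ≤ f M (x i)} s := by
    filter_upwards [hcon] with i hi
    have hcl : IsClopen {M | f M (x i) < η} :=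
      isClopen_preimage_of_isLocallyConstant hf {g | g (x i) < η}
    refine ((large_or_large_compl hcl s).resolve_left hi).mono fun M hM => ?_
    simpa using hM
  set A : Set ℕ := {i | Large {M | η ≤ f M (x i)} s}
  have hdisj : Disjoint (Metric.ball (0 : X) η) (convexHull ℝ (x '' A)) := by
    rw [Set.disjoint_left]
    intro z hz hzA
    rw [convexHull_eq_union_convexHull_finite_subsets] at hzA
    simp only [Set.mem_iUnion] at hzA
    obtain ⟨t, htA, hzt⟩ := hzA
    have hlt : Large {M | ∀ v ∈ t, M ∈ {M | η ≤ f M v}} s := by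
      refine large_biInter t _ fun v hv => ?_
      obtain ⟨i, hi, rfl⟩ := htA hv
      exact hi
    obtain ⟨M, hM, -⟩ := hlt.exists_mem
    have hsub : convexHull ℝ (t : Set X) ⊆ {v | η ≤ f M v} :=
      convexHull_min (fun v hv => hM v hv) (convex_halfSpace_ge (f M).isLinear η)
    have h1 : η ≤ f M z := hsub hzt
    have h2 : f M z ≤ ‖z‖ := (le_abs_self _).trans ((f M).le_of_opNorm_le (hf1 M) z |>.trans
      (by rw [one_mul]))
    rw [mem_ball_zero_iff] at hz
    linarith
  obtain ⟨g, r, hg1, hg2⟩ :=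
    geometric_hahn_banach_open (convex_ball 0 η) Metric.isOpen_ball (convex_convexHull ℝ _) hdisj
  have hr : 0 < r := by simpa using hg1 0 (Metric.mem_ball_self hη)
  have hev : ∀ᶠ i in hyperfilter ℕ, g (x i) < r :=
    Nat.hyperfilter_le_atTop ((hx g).eventually_lt_const hr)
  obtain ⟨i, hi, hiA⟩ := (hev.and hcon').exists
  exact absurd (hg2 _ (subset_convexHull ℝ _ ⟨i, hiA, rfl⟩)) (not_le.2 hi)

/-- For a locally constant family of functionals in the dual unit ball, a weakly null sequence has
a subsequence such that the functional associated with a set `M` is as small as desired on the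
members of the subsequence whose index is not in `M`. -/
theorem exists_subseq_abs_lt {x : ℕ → X}
    (hx : ∀ g : StrongDual ℝ X, Tendsto (fun i => g (x i)) atTop (𝓝 0))
    {f : InfSubset → StrongDual ℝ X} (hf : IsLocallyConstant f) (hf1 : ∀ M, ‖f M‖ ≤ 1)
    {η : ℕ → ℝ} (hη : ∀ j, 0 < η j) :
    ∃ φ : ℕ → ℕ, StrictMono φ ∧ ∀ M : InfSubset, M.1 ⊆ Set.range φ →
      ∀ j, φ j ∉ M.1 → |f M (x (φ j))| < η j := by
  obtain ⟨φ, hφ, h⟩ := exists_fusion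
    (fun j _ m b => if b then Set.univ else {M | |f M (x m)| < η j}) (fun j _ m b => by
      cases b
      · exact isClopen_preimage_of_isLocallyConstant hf {g | |g (x m)| < η j}
      · exact isClopen_univ) (fun j s b => by
      cases b
      · have h' := eventually_large_lt (x := fun i => -x i) (fun g => by simpa using (hx g).neg)
          hf hf1 (hη j) s
        filter_upwards [eventually_large_lt hx hf hf1 (hη j) s, h'] with m h1 h2
        refine (h1.inter h2).mono fun M hM => ?_
        have h3 : f M (x m) < η j := hM.1
        have h4 : f M (-x m) < η j := hM.2
        rw [map_neg] at h4
        exact abs_lt.2 ⟨by linarith, h3⟩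
      · exact Eventually.of_forall fun m => large_univ _)
  refine ⟨φ, hφ, fun M hM j hj => ?_⟩
  have := h M hM j
  simpa [hj] using this

/-! ### Subsequences with good basis constants -/

theorem NormalizedWeaklyNull.comp {x : ℕ → X} (hx : NormalizedWeaklyNull x) {φ : ℕ → ℕ}
    (hφ : StrictMono φ) : NormalizedWeaklyNull (x ∘ φ) :=
  ⟨fun i => hx.norm_eq_one (φ i), fun f => (hx.weakly_null f).comp hφ.tendsto_atTop⟩

theorem coeff_le_comp {x : ℕ → X} {C : ℝ} (h : ∀ (a : ℕ →₀ ℝ) (i : ℕ), |a i| ≤ C * ‖comb x a‖)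
    {φ : ℕ → ℕ} (hφ : StrictMono φ) (a : ℕ →₀ ℝ) (i : ℕ) : |a i| ≤ C * ‖comb (x ∘ φ) a‖ := by
  rw [comb_comp, ← Finsupp.mapDomain_apply hφ.injective a i]
  exact h _ _

theorem BasicWithConst.comp {x : ℕ → X} {C : ℝ} (h : BasicWithConst x C)
    {φ : ℕ → ℕ} (hφ : StrictMono φ) : BasicWithConst (x ∘ φ) C := by
  refine ⟨fun i => h.ne_zero (φ i), fun a n => ?_⟩
  rw [comb_comp]
  refine le_of_eq_of_le ?_ (h.proj_le (a.mapDomain φ) (φ n))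
  have hsub : (Finset.range n).image φ ⊆ Finset.range (φ n) := by
    intro i hi
    obtain ⟨k, hk, rfl⟩ := Finset.mem_image.1 hi
    exact Finset.mem_range.2 (hφ (Finset.mem_range.1 hk))
  rw [← Finset.sum_subset hsub, Finset.sum_image hφ.injective.injOn]
  · simp only [Finsupp.mapDomain_apply hφ.injective, Function.comp_apply]
  · intro i hi hi'
    by_cases hr : i ∈ Set.range φ
    · obtain ⟨k, rfl⟩ := hr
      exact absurd (Finset.mem_image_of_mem φ
        (Finset.mem_range.2 (hφ.lt_iff_lt.1 (Finset.mem_range.1 hi)))) hi'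
    · rw [Finsupp.mapDomain_of_notMem_range _ _ hr, zero_smul]

theorem exists_norming (x : X) : ∃ g : StrongDual ℝ X, ‖g‖ ≤ 1 ∧ g x = ‖x‖ := by
  simpa using exists_dual_vector'' ℝ x

theorem abs_apply_le {g : StrongDual ℝ X} (hg : ‖g‖ ≤ 1) (x : X) : |g x| ≤ ‖x‖ := by
  simpa using g.le_of_opNorm_le hg x

/-- Weak nullness makes a norming functional of one term small on later terms. Smallness on earlier
terms is the real issue, and comes from `exists_subseq_abs_lt` applied to the norming functional of
the term indexed by `min M`. A vector is then tested on the functional of its largest coefficient.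
-/
theorem exists_subseq_coeff_le {x : ℕ → X} (hx : NormalizedWeaklyNull x) {ε : ℝ} (hε : 0 < ε)
    (hε1 : ε < 1) : ∃ φ : ℕ → ℕ, StrictMono φ ∧
      ∀ (a : ℕ →₀ ℝ) (i : ℕ), |a i| ≤ (1 + ε) * ‖comb (x ∘ φ) a‖ := by
  choose g hg1 hg using fun i => exists_norming (x i)
  have hlc : IsLocallyConstant fun M : InfSubset => g (sInf M.1) := by
    refine isLocallyConstant_iff_infSubset.2 fun M => ⟨sInf M.1 + 1, fun M' h => ?_⟩
    have hM : sInf M.1 ∈ M.1 := Nat.sInf_mem M.2.nonempty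
    have h1 : sInf M'.1 ≤ sInf M.1 := Nat.sInf_le ((h _ (Nat.lt_succ_self _)).2 hM)
    have h2 : sInf M.1 ≤ sInf M'.1 :=
      Nat.sInf_le ((h _ (Nat.lt_succ_of_le h1)).1 (Nat.sInf_mem M'.2.nonempty))
    simp only [le_antisymm h1 h2]
  obtain ⟨φ, hφ, h⟩ := exists_subseq_abs_lt hx.weakly_null hlc (fun M => hg1 _)
    (η := fun j => ε / 4 * (1 / 2) ^ (j + 1)) (fun j => by positivity)
  have hoff : ∀ i j, j ≠ i → |g (φ i) (x (φ j))| < ε / 4 * (1 / 2) ^ (j + 1) := by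
    intro i j hij
    -- The tail starts beyond both indices, so `φ i` is the minimum and `φ j` is omitted even when
    -- `j < i`.
    let M : InfSubset := ⟨φ '' ({i} ∪ Set.Ioi (max i j)), ((Set.Ioi_infinite _).mono
      Set.subset_union_right).image hφ.injective.injOn⟩
    have hmin : sInf M.1 = φ i := by
      refine le_antisymm (Nat.sInf_le ⟨i, by simp, rfl⟩) (le_csInf M.2.nonempty ?_)
      rintro _ ⟨k, hk | hk, rfl⟩
      · rw [Set.mem_singleton_iff.1 hk]
      · exact hφ.monotone ((le_max_left i j).trans (le_of_lt hk))
    have := h M (Set.image_subset_range _ _) j (by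
      rintro ⟨k, hk, hkj⟩
      have := hφ.injective hkj
      subst this
      rcases hk with hk | hk
      · exact hij hk
      · exact absurd hk (by simp))
    simpa only [hmin] using this
  refine ⟨φ, hφ, fun a i => ?_⟩
  rcases eq_or_ne a 0 with rfl | ha
  · simp only [Finsupp.coe_zero, Pi.zero_apply, abs_zero]
    positivity
  obtain ⟨k, hk, hmax⟩ := Finset.exists_max_image a.support (fun i => |a i|)
    (Finsupp.support_nonempty_iff.2 ha)
  have hle : ∀ i, |a i| ≤ |a k| := fun i => by
    by_cases hi : i ∈ a.support
    · exact hmax i hi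
    · rw [Finsupp.notMem_support_iff.1 hi, abs_zero]
      exact abs_nonneg _
  refine (hle i).trans ?_
  have hsum : g (φ k) (comb (x ∘ φ) a) =
      a k + ∑ j ∈ a.support.erase k, a j * g (φ k) (x (φ j)) := by
    rw [comb, map_sum, ← Finset.add_sum_erase _ _ hk]
    simp [hg, hx.norm_eq_one]
  have hrest := sum_mul_le_of_le_half_pow (S := a.support.erase k) (a := a)
    (b := fun j => g (φ k) (x (φ j))) (A := |a k|) (c := ε / 4) (by positivity) (abs_nonneg _)
    (fun j _ => hle j) (fun j hj => (hoff k j (Finset.ne_of_mem_erase hj)).le)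
  have hbd := abs_apply_le (hg1 (φ k)) (comb (x ∘ φ) a)
  have htri : |a k| ≤ |g (φ k) (comb (x ∘ φ) a)| +
      |∑ j ∈ a.support.erase k, a j * g (φ k) (x (φ j))| := by
    rw [hsum]
    simpa using abs_sub (a k + ∑ j ∈ a.support.erase k, a j * g (φ k) (x (φ j)))
      (∑ j ∈ a.support.erase k, a j * g (φ k) (x (φ j)))
  have h1 : |a k| * (1 - ε / 4) ≤ ‖comb (x ∘ φ) a‖ := by linarith
  have h2 : 1 ≤ (1 + ε) * (1 - ε / 4) := by nlinarith
  nlinarith [abs_nonneg (a k)]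

/-- By compactness of the unit sphere of a finite-dimensional space, finitely many norming
functionals suffice. -/
theorem exists_finset_norming (x : ℕ → X) (s : Finset ℕ) {θ : ℝ} (hθ : θ < 1) :
    ∃ N : Finset (StrongDual ℝ X), (∀ g ∈ N, ‖g‖ ≤ 1) ∧
      ∀ v ∈ Submodule.span ℝ (x '' s), ∃ g ∈ N, θ * ‖v‖ ≤ g v := by
  classical
  choose g hg1 hg using fun v : X => exists_norming v
  set V := Submodule.span ℝ (x '' s)
  have : FiniteDimensional ℝ V := FiniteDimensional.span_of_finite ℝ (s.finite_toSet.image x)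
  have : ProperSpace V := FiniteDimensional.proper_real V
  obtain ⟨t, ht, hcov⟩ := (isCompact_sphere (0 : V) 1).elim_nhds_subcover
    (fun v => {v' : V | θ < g v v'}) (fun v hv => by
      refine ((g v).continuous.comp continuous_subtype_val).continuousAt.eventually_const_lt ?_
      have : ‖(v : X)‖ = 1 := by simpa using hv
      simpa [hg, this] using hθ)
  -- The zero functional serves the zero vector when the span is trivial and `t` may be empty.
  refine ⟨insert 0 (t.image fun v : V => g v), fun f hf => ?_, fun v hv => ?_⟩
  · rcases Finset.mem_insert.1 hf with rfl | hf
    · simp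
    · obtain ⟨v, -, rfl⟩ := Finset.mem_image.1 hf
      exact hg1 v
  · rcases eq_or_ne v 0 with rfl | hv0
    · exact ⟨0, by simp, by simp⟩
    have hpos : 0 < ‖v‖ := norm_pos_iff.2 hv0
    have hmem : (⟨‖v‖⁻¹ • v, V.smul_mem _ hv⟩ : V) ∈ Metric.sphere (0 : V) 1 := by
      rw [mem_sphere_zero_iff_norm, Submodule.coe_norm, norm_smul, norm_inv, norm_norm]
      exact inv_mul_cancel₀ hpos.ne'
    obtain ⟨w, hw, hwv⟩ := Set.mem_iUnion₂.1 (hcov hmem)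
    refine ⟨g w, by simp only [Finset.mem_insert, Finset.mem_image]; exact Or.inr ⟨w, hw, rfl⟩, ?_⟩
    have h1 : θ < ‖v‖⁻¹ * g w v := by simpa using hwv
    have h2 : ‖v‖ * (‖v‖⁻¹ * g w v) = g w v := by rw [← mul_assoc, mul_inv_cancel₀ hpos.ne', one_mul]
    nlinarith

/-- Mazur's construction: each new term is nearly annihilated by the finite norming sets for the
earlier terms. The coefficient bound controls the tail, so an almost norming functional of the
initial part nearly bounds it by the norm of the whole vector. -/
theorem exists_subseq_basic {x : ℕ → X} (hx : NormalizedWeaklyNull x) {ε : ℝ} (hε : 0 < ε)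
    (hε1 : ε < 1) : ∃ φ : ℕ → ℕ, StrictMono φ ∧ BasicWithConst (x ∘ φ) (1 + ε) ∧
      ∀ (a : ℕ →₀ ℝ) (i : ℕ), |a i| ≤ (1 + ε) * ‖comb (x ∘ φ) a‖ := by
  obtain ⟨φ, hφ, hcoeff⟩ := exists_subseq_coeff_le hx hε hε1
  set y := x ∘ φ
  have hy : NormalizedWeaklyNull y := hx.comp hφ
  have hθ : (1 + ε / 2)⁻¹ < 1 := inv_lt_one_of_one_lt₀ (by linarith)
  choose N hN1 hN using fun s => exists_finset_norming y s hθ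
  obtain ⟨ψ, hψ, h⟩ := exists_strictMono_forall_mem (fun t => {m | ∀ s ∈ t.powerset, ∀ g ∈ N s,
      |g (y m)| < ε / 8 * (1 / 2) ^ (t.card + 1)}) (fun t => by
    refine (Filter.Eventually.filter_mono Nat.hyperfilter_le_atTop (p := fun m =>
      ∀ s ∈ t.powerset, ∀ g ∈ N s, |g (y m)| < ε / 8 * (1 / 2) ^ (t.card + 1)) ?_)
    simp only [eventually_all_finset]
    intro s _ g _
    have := (hy.weakly_null g).abs
    rw [abs_zero] at this
    exact this.eventually_lt_const (by positivity))
  refine ⟨φ ∘ ψ, hφ.comp hψ, ⟨fun i => ?_, fun a n => ?_⟩, coeff_le_comp hcoeff hψ⟩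
  · rw [← norm_ne_zero_iff]
    simp [hx.norm_eq_one]
  change ‖∑ i ∈ Finset.range n, a i • y (ψ i)‖ ≤ (1 + ε) * ‖comb (y ∘ ψ) a‖
  set u := ∑ i ∈ Finset.range n, a i • y (ψ i)
  set s := (Finset.range n).image ψ
  have hu : u ∈ Submodule.span ℝ (y '' s) := by
    refine Submodule.sum_mem _ fun i hi => Submodule.smul_mem _ _ (Submodule.subset_span ?_)
    exact ⟨ψ i, Finset.mem_coe.2 (Finset.mem_image_of_mem ψ hi), rfl⟩
  obtain ⟨g, hg, hgu⟩ := hN s u hu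
  have hsmall : ∀ i, n ≤ i → |g (y (ψ i))| ≤ ε / 8 * (1 / 2) ^ (i + 1) := by
    intro i hi
    have := h i s (Finset.mem_powerset.2
      (Finset.image_subset_image (Finset.range_subset_range.2 hi))) g hg
    rw [Finset.card_image_of_injective _ hψ.injective, Finset.card_range] at this
    exact this.le
  have hsplit : g (comb (y ∘ ψ) a) =
      g u + ∑ i ∈ (a.support ∪ Finset.range n) \ Finset.range n, a i * g (y (ψ i)) := by
    rw [comb_eq_sum _ (Finset.subset_union_left (s₂ := Finset.range n)),
      ← Finset.sum_sdiff (Finset.subset_union_right (s₁ := a.support)), map_add, add_comm, map_sum]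
    simp [u]
  have hrest := sum_mul_le_of_le_half_pow
    (S := (a.support ∪ Finset.range n) \ Finset.range n) (a := a)
    (b := fun j => g (y (ψ j))) (A := (1 + ε) * ‖comb (y ∘ ψ) a‖) (c := ε / 8) (by positivity)
    (by positivity) (fun j _ => coeff_le_comp hcoeff hψ a j)
    (fun j hj => hsmall j (by simpa using (Finset.mem_sdiff.1 hj).2))
  have hbd := (abs_le.1 (abs_apply_le (hN1 s g hg) (comb (y ∘ ψ) a))).2
  have h1 := (abs_le.1 hrest).1
  -- The tail contributes at most `(1 + ε) * ε / 8 ≤ ε / 4` times the norm.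
  have h2 : (1 + ε / 2)⁻¹ * ‖u‖ ≤ (1 + ε / 4) * ‖comb (y ∘ ψ) a‖ := by
    have h5 : 0 ≤ (1 - ε) * (ε / 8) * ‖comb (y ∘ ψ) a‖ :=
      mul_nonneg (mul_nonneg (by linarith) (by linarith)) (norm_nonneg _)
    linarith
  have h3 : ‖u‖ ≤ (1 + ε / 2) * ((1 + ε / 4) * ‖comb (y ∘ ψ) a‖) :=
    (inv_mul_le_iff₀ (by positivity)).1 h2
  have h4 : (1 + ε / 2) * (1 + ε / 4) ≤ 1 + ε := by nlinarith
  nlinarith [norm_nonneg (comb (y ∘ ψ) a)]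

/-! ### Locally constant selections of witnesses -/

/-- The data `w = (a, x*, F)` witness, with coefficients supported in `s`, that the constant of
the sequence `x` is large. -/
structure IsFinWitness (δ C : ℝ) (x : ℕ → X) (s : Set ℕ) (w : WitnessData X) : Prop where
  norm_f_le : ‖w.f‖ ≤ 1
  support_subset : ∀ i ∈ w.a.support, i ∈ s
  mem_F : ∀ i ∈ w.F, δ ≤ w.a i ∧ 0 < w.f (x i)
  norm_comb : ‖comb x w.a‖ = 1
  lt_sum : C < ∑ i ∈ w.F, w.a i * w.f (x i)

theorem IsFinWitness.mem_support {δ C : ℝ} {x : ℕ → X} {s : Set ℕ} {w : WitnessData X}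
    (h : IsFinWitness δ C x s w) (hδ : 0 < δ) {i : ℕ} (hi : i ∈ w.F) : i ∈ w.a.support :=
  Finsupp.mem_support_iff.2 (hδ.trans_le (h.mem_F i hi).1).ne'

theorem IsFinWitness.mono {δ C : ℝ} {x : ℕ → X} {s t : Set ℕ} {w : WitnessData X}
    (h : IsFinWitness δ C x s w) (ht : ∀ i ∈ w.a.support, i ∈ t) : IsFinWitness δ C x t w :=
  ⟨h.norm_f_le, ht, h.mem_F, h.norm_comb, h.lt_sum⟩

/-- Only terms in which `a i` and `g (x i)` have the same sign contribute positively. One of the two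
signs carries at least half of the sum; if it is the negative one, both `a` and `g` are negated. -/
theorem exists_finWitness_of_sum_lt {δ C : ℝ} {x : ℕ → X} {a : ℕ →₀ ℝ} {E : Finset ℕ}
    {g : StrongDual ℝ X} (ha : ‖comb x a‖ = 1) (hE : ∀ i ∈ E, δ ≤ |a i|) (hg : ‖g‖ ≤ 1)
    (hC : 2 * C < ∑ i ∈ E, a i * g (x i)) : ∃ w, IsFinWitness δ C x Set.univ w := by
  classical
  have hle : ∑ i ∈ E, a i * g (x i) ≤
      ∑ i ∈ E with 0 < a i ∧ 0 < g (x i), a i * g (x i) +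
        ∑ i ∈ E with a i < 0 ∧ g (x i) < 0, a i * g (x i) := by
    rw [Finset.sum_filter, Finset.sum_filter, ← Finset.sum_add_distrib]
    refine Finset.sum_le_sum fun i _ => ?_
    split_ifs with h1 h2 h2
    · linarith [h1.1, h2.1]
    · simp
    · simp
    · rw [add_zero]
      by_contra hcon
      rcases pos_and_pos_or_neg_and_neg_of_mul_pos (not_le.1 hcon) with h | h
      exacts [h1 h, h2 h]
  rcases lt_or_ge C (∑ i ∈ E with 0 < a i ∧ 0 < g (x i), a i * g (x i)) with h | h
  · refine ⟨⟨a, g, E.filter fun i => 0 < a i ∧ 0 < g (x i)⟩, hg, fun _ _ => trivial,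
      fun i hi => ?_, ha, h⟩
    obtain ⟨h1, h2, h3⟩ := Finset.mem_filter.1 hi
    exact ⟨(hE i h1).trans (abs_of_pos h2).le, h3⟩
  · refine ⟨⟨-a, -g, E.filter fun i => a i < 0 ∧ g (x i) < 0⟩, by simpa using hg,
      fun _ _ => trivial, fun i hi => ?_, ?_, ?_⟩
    · obtain ⟨h1, h2, h3⟩ := Finset.mem_filter.1 hi
      exact ⟨(hE i h1).trans (abs_of_neg h2).le, by simpa using h3⟩
    · have := comb_smul x (-1) a
      simp only [neg_smul, one_smul] at this
      simpa [this] using ha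
    · simp only [Finsupp.coe_neg, Pi.neg_apply, neg_apply, neg_mul_neg]
      linarith

theorem exists_lt_norm_of_lt_kPrimeSeq {x : ℕ → X} {δ : ℝ} {C : ℝ≥0} (h : C < kPrimeSeq x δ) :
    ∃ (a : ℕ →₀ ℝ) (E : Finset ℕ), (∀ i ∈ E, δ ≤ |a i|) ∧ ‖comb x a‖ ≤ 1 ∧
      C * ‖comb x a‖ < ‖∑ i ∈ E, a i • x i‖ := by
  by_contra! hcon
  exact absurd h (not_lt.2 (iInf₂_le C hcon))

/-- Since the norm of the vector is at most 1, normalizing it only enlarges coefficients, so the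
lower bound `δ` survives. -/
theorem exists_finWitness_univ {x : ℕ → X} (hinj : ∀ a : ℕ →₀ ℝ, comb x a = 0 → a = 0)
    {δ : ℝ} {C : ℝ≥0} (h : C < kPrimeSeq x δ) :
    ∃ w, IsFinWitness δ (C / 2) x Set.univ w := by
  obtain ⟨a, E, hE, ha1, hlt⟩ := exists_lt_norm_of_lt_kPrimeSeq h
  have ha : comb x a ≠ 0 := by
    intro h0
    rw [h0, norm_zero, mul_zero] at hlt
    have := hinj a h0
    subst this
    simp at hlt
  have hpos : 0 < ‖comb x a‖ := norm_pos_iff.2 ha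
  set r := ‖comb x a‖
  obtain ⟨g, hg1, hg⟩ := exists_norming (∑ i ∈ E, a i • x i)
  refine exists_finWitness_of_sum_lt (a := r⁻¹ • a) (E := E) (g := g) ?_ (fun i hi => ?_) hg1 ?_
  · rw [comb_smul, norm_smul, norm_inv, Real.norm_of_nonneg hpos.le]
    exact inv_mul_cancel₀ hpos.ne'
  · rw [Finsupp.smul_apply, smul_eq_mul, abs_mul, abs_of_pos (inv_pos.2 hpos)]
    exact (hE i hi).trans (le_mul_of_one_le_left (abs_nonneg _) ((one_le_inv₀ hpos).2 ha1))
  · have h1 : ∑ i ∈ E, (r⁻¹ • a) i * g (x i) = r⁻¹ * ‖∑ i ∈ E, a i • x i‖ := by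
      rw [← hg, map_sum, Finset.mul_sum]
      simp [mul_assoc]
    rw [h1, lt_inv_mul_iff₀ hpos]
    linarith

theorem exists_finWitness {x : ℕ → X} (hinj : ∀ a : ℕ →₀ ℝ, comb x a = 0 → a = 0)
    {δ : ℝ} {C : ℝ≥0} (h : ∀ φ : ℕ → ℕ, StrictMono φ → C < kPrimeSeq (x ∘ φ) δ)
    (M : InfSubset) : ∃ w, IsFinWitness δ (C / 2) x M.1 w := by
  classical
  have : Infinite M.1 := M.2.to_subtype
  set φ : ℕ → ℕ := fun n => Nat.orderEmbeddingOfSet M.1 n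
  have hφ : StrictMono φ := (Nat.orderEmbeddingOfSet M.1).strictMono
  have hrange : Set.range φ = M.1 := Nat.orderEmbeddingOfSet_range M.1
  obtain ⟨w, hw⟩ := exists_finWitness_univ (x := x ∘ φ) (fun a ha => by
    rw [comb_comp] at ha
    exact Finsupp.mapDomain_injective hφ.injective ((hinj _ ha).trans Finsupp.mapDomain_zero.symm))
    (h φ hφ)
  refine ⟨⟨w.a.mapDomain φ, w.f, w.F.image φ⟩, hw.norm_f_le, fun i hi => ?_, fun i hi => ?_,
    (comb_comp x φ w.a) ▸ hw.norm_comb, ?_⟩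
  · obtain ⟨k, -, rfl⟩ := Finset.mem_image.1 (Finsupp.mapDomain_support hi)
    exact hrange ▸ Set.mem_range_self k
  · obtain ⟨k, hk, rfl⟩ := Finset.mem_image.1 hi
    have := hw.mem_F k hk
    simpa only [Finsupp.mapDomain_apply hφ.injective, Function.comp_apply] using this
  · have := hw.lt_sum
    rw [Finset.sum_image hφ.injective.injOn]
    simpa only [Finsupp.mapDomain_apply hφ.injective, Function.comp_apply] using this

theorem seg_congr {M M' : Set ℕ} {n : ℕ} (h : ∀ i < n, (i ∈ M' ↔ i ∈ M)) : seg M' n = seg M n := by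
  ext i
  rw [mem_seg, mem_seg]
  exact and_congr_right fun hi => h i hi

/-- Witnesses can be selected depending only on initial segments. -/
theorem exists_locallyConstant_finWitness {x : ℕ → X} {δ C : ℝ}
    (h : ∀ M : InfSubset, ∃ w, IsFinWitness δ C x M.1 w) :
    ∃ w : InfSubset → WitnessData X, IsLocallyConstant w ∧
      ∀ M : InfSubset, IsFinWitness δ C x M.1 (w M) := by
  classical
  have : Nonempty (WitnessData X) := ⟨⟨0, 0, ∅⟩⟩
  choose W hW using fun s : Finset ℕ =>
    (exists_or_forall_not (fun w => IsFinWitness δ C x (s : Set ℕ) w)).elim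
      (fun ⟨w, hw⟩ => ⟨w, fun _ => hw⟩)
      (fun hs => (⟨⟨0, 0, ∅⟩, fun ⟨w, hw⟩ => absurd hw (hs w)⟩ : ∃ w : WitnessData X,
        (∃ w', IsFinWitness δ C x (s : Set ℕ) w') → IsFinWitness δ C x (s : Set ℕ) w))
  have hex : ∀ M : InfSubset, ∃ n, ∃ w, IsFinWitness δ C x (seg M.1 n : Set ℕ) w := by
    intro M
    obtain ⟨w, hw⟩ := h M
    refine ⟨w.a.support.sup id + 1, w, hw.mono fun i hi => Finset.mem_coe.2 (mem_seg.2 ⟨?_, ?_⟩)⟩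
    · exact Nat.lt_succ_of_le (Finset.le_sup (f := id) hi)
    · exact hw.support_subset i hi
  -- The shortest initial segment carrying a witness is used. It is recognized from that segment
  -- alone, which gives local constancy.
  refine ⟨fun M => W (seg M.1 (Nat.find (hex M))), isLocallyConstant_iff_infSubset.2 fun M =>
    ⟨Nat.find (hex M), fun M' hM' => ?_⟩, fun M => ?_⟩
  · have hseg : ∀ k ≤ Nat.find (hex M), seg M'.1 k = seg M.1 k := fun k hk =>
      seg_congr fun i hi => hM' i (hi.trans_le hk)
    have hfind : Nat.find (hex M') = Nat.find (hex M) := by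
      rw [Nat.find_eq_iff]
      refine ⟨?_, fun k hk => ?_⟩
      · rw [hseg _ le_rfl]
        exact Nat.find_spec (hex M)
      · rw [hseg _ hk.le]
        exact Nat.find_min (hex M) hk
    simp only [hfind, hseg _ le_rfl]
  · exact (hW _ (Nat.find_spec (hex M))).mono fun i hi => (mem_seg.1
      ((hW _ (Nat.find_spec (hex M))).support_subset i hi)).2

/-- A basic sequence together with a locally constant selection of witnesses, whose functionals
almost vanish off their index sets. -/
structure IsSelection (δ ε C : ℝ) (x : ℕ → X) (w : InfSubset → WitnessData X) : Prop where
  normalizedWeaklyNull : NormalizedWeaklyNull x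
  basic : BasicWithConst x (1 + ε)
  coeff_le : ∀ (a : ℕ →₀ ℝ) (i : ℕ), |a i| ≤ (1 + ε) * ‖comb x a‖
  isFinWitness : ∀ M : InfSubset, IsFinWitness δ C x M.1 (w M)
  continuous : IsLocallyConstant w
  sum_le : ∀ (M : InfSubset) (S : Finset ℕ), (∀ i ∈ S, i ∉ M.1) →
    ∑ i ∈ S, |(w M).f (x i)| ≤ ε / 2

/-- The image of an infinite set under a strictly increasing map. -/
def InfSubset.image {φ : ℕ → ℕ} (hφ : StrictMono φ) (M : InfSubset) : InfSubset :=
  ⟨φ '' M.1, M.2.image hφ.injective.injOn⟩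

theorem isLocallyConstant_comp_image {α : Type*} {g : InfSubset → α} (hg : IsLocallyConstant g)
    {φ : ℕ → ℕ} (hφ : StrictMono φ) : IsLocallyConstant fun M => g (InfSubset.image hφ M) := by
  rw [isLocallyConstant_iff_infSubset] at hg ⊢
  intro M
  obtain ⟨n, hn⟩ := hg (InfSubset.image hφ M)
  refine ⟨n, fun M' h => hn _ fun i hi => ?_⟩
  change i ∈ φ '' M'.1 ↔ i ∈ φ '' M.1
  constructor
  · rintro ⟨k, hk, rfl⟩
    exact ⟨k, (h k (hφ.le_apply.trans_lt hi)).1 hk, rfl⟩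
  · rintro ⟨k, hk, rfl⟩
    exact ⟨k, (h k (hφ.le_apply.trans_lt hi)).2 hk, rfl⟩

/-- The data obtained by passing to the subsequence given by `φ`. -/
noncomputable def WitnessData.comap {φ : ℕ → ℕ} (hφ : StrictMono φ) (w : WitnessData X) :
    WitnessData X :=
  ⟨w.a.comapDomain φ hφ.injective.injOn, w.f, w.F.preimage φ hφ.injective.injOn⟩

theorem IsFinWitness.comap {δ C : ℝ} {x : ℕ → X} {M : InfSubset} {w : WitnessData X}
    (hδ : 0 < δ) {φ : ℕ → ℕ} (hφ : StrictMono φ)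
    (h : IsFinWitness δ C x (InfSubset.image hφ M).1 w) :
    IsFinWitness δ C (x ∘ φ) M.1 (w.comap hφ) := by
  classical
  have hsupp : ∀ i ∈ w.a.support, i ∈ Set.range φ := fun i hi =>
    Set.image_subset_range _ _ (h.support_subset i hi)
  refine ⟨h.norm_f_le, fun i hi => ?_, fun i hi => h.mem_F (φ i) (by
    simpa [WitnessData.comap] using hi), ?_, ?_⟩
  · obtain ⟨k, hk, hki⟩ := h.support_subset (φ i) (by simpa [WitnessData.comap] using hi)
    exact hφ.injective hki ▸ hk
  · rw [comb_comp]
    change ‖comb x ((w.a.comapDomain φ _).mapDomain φ)‖ = 1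
    rw [Finsupp.mapDomain_comapDomain φ hφ.injective w.a hsupp]
    exact h.norm_comb
  · refine h.lt_sum.trans_eq ?_
    exact (Finset.sum_preimage φ w.F hφ.injective.injOn (fun i => w.a i * w.f (x i))
      fun i hi hi' => absurd (hsupp i (h.mem_support hδ hi)) hi').symm

theorem exists_isSelection {δ ε : ℝ} (hδ : 0 < δ) (hε : 0 < ε) (hε1 : ε < 1) {C : ℝ≥0}
    (h : C < kPrime.{u} δ) : ∃ (X : Type u) (_ : NormedAddCommGroup X) (_ : NormedSpace ℝ X)
      (_ : CompleteSpace X) (x : ℕ → X) (w : InfSubset → WitnessData X),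
      IsSelection δ ε (C / 2) x w := by
  simp only [kPrime, lt_iSup_iff] at h
  obtain ⟨X, i1, i2, i3, y, hy, hlt⟩ := h
  obtain ⟨φ, hφ, hbasic, hcoeff⟩ := exists_subseq_basic hy hε hε1
  set x := y ∘ φ
  have hx : NormalizedWeaklyNull x := hy.comp hφ
  have hK : ∀ ψ : ℕ → ℕ, StrictMono ψ → C < kPrimeSeq (x ∘ ψ) δ := fun ψ hψ =>
    hlt.trans_le (iInf₂_le (φ ∘ ψ) (hφ.comp hψ))
  have hinj : ∀ a : ℕ →₀ ℝ, comb x a = 0 → a = 0 := by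
    intro a ha
    ext i
    have := hcoeff a i
    rw [ha, norm_zero, mul_zero] at this
    simpa using this
  obtain ⟨w, hw, hwit⟩ := exists_locallyConstant_finWitness (exists_finWitness hinj hK)
  -- Thinning comes after the witnesses are chosen: the set `M` of new indices inherits the witness
  -- of its image under `ψ`. The summable bounds give total mass at most `ε / 2` off `M`.
  obtain ⟨ψ, hψ, hsmall⟩ := exists_subseq_abs_lt hx.weakly_null
    (f := fun M => (w M).f) (hw.comp WitnessData.f) (fun M => (hwit M).norm_f_le)
    (η := fun j => ε / 2 * (1 / 2) ^ (j + 1)) (fun j => by positivity)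
  refine ⟨X, i1, i2, i3, x ∘ ψ, fun M => (w (InfSubset.image hψ M)).comap hψ, hx.comp hψ,
    hbasic.comp hψ, coeff_le_comp hcoeff hψ, fun M => (hwit _).comap hδ hψ,
    (isLocallyConstant_comp_image hw hψ).comp (WitnessData.comap hψ), fun M S hS => ?_⟩
  calc ∑ i ∈ S, |(w (InfSubset.image hψ M)).f (x (ψ i))|
      ≤ ∑ i ∈ S, ε / 2 * (1 / 2) ^ (i + 1) := by
        refine Finset.sum_le_sum fun i hi => (hsmall _ (Set.image_subset_range _ _) i ?_).le
        rintro ⟨k, hk, hki⟩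
        exact hS i hi (hψ.injective hki ▸ hk)
    _ = ε / 2 * ∑ i ∈ S, (1 / 2) ^ (i + 1) := by rw [Finset.mul_sum]
    _ ≤ ε / 2 := mul_le_of_le_one_right (by positivity) (sum_half_pow_le S)

/-! ### Finiteness of the constants -/

/-- The sets of a locally constant family of finite sets can be predicted from initial segments,
after passing to a subset. -/
theorem exists_subseq_predict {F : InfSubset → Finset ℕ} (hF : IsLocallyConstant F) :
    ∃ (φ : ℕ → ℕ) (c : Finset ℕ → Prop), StrictMono φ ∧ ∀ M : InfSubset, M.1 ⊆ Set.range φ →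
      ∀ m ∈ M.1, (m ∈ F M ↔ c (seg M.1 m)) := by
  classical
  -- The prediction for the next element after the segment `s` is the answer forced for almost every
  -- candidate. By the dichotomy, one of the two answers is forced.
  let c : Finset ℕ → Prop := fun s =>
    ∀ᶠ m in hyperfilter ℕ, Large {M | m ∈ F M} (insert m s)
  have hcl : ∀ m (p : Prop), IsClopen {M | m ∈ F M ↔ p} := fun m p =>
    isClopen_preimage_of_isLocallyConstant hF {s | m ∈ s ↔ p}
  obtain ⟨φ, hφ, h⟩ := exists_fusion
    (fun _ s m b => if b then {M | m ∈ F M ↔ c s} else Set.univ) (fun _ s m b => by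
      cases b
      · exact isClopen_univ
      · exact hcl m (c s)) (fun _ s b => by
      cases b
      · exact Eventually.of_forall fun m => large_univ _
      · by_cases hc : c s
        · filter_upwards [(show ∀ᶠ m in hyperfilter ℕ, Large {M | m ∈ F M} (insert m s) from hc)]
            with m hm
          exact hm.mono fun M hM => iff_of_true hM hc
        · filter_upwards [Ultrafilter.eventually_not.2 hc] with m hm
          have hcl' : IsClopen {M | m ∈ F M} :=
            isClopen_preimage_of_isLocallyConstant hF {s | m ∈ s}
          exact ((large_or_large_compl hcl' _).resolve_left hm).mono fun M hM =>
            iff_of_false hM hc)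
  refine ⟨φ, c, hφ, fun M hM m hm => ?_⟩
  obtain ⟨j, rfl⟩ := hM hm
  simpa [hm] using h M hM j

/-- Two finite sets that match with respect to `c`: an element of one of them belongs to the other
one if and only if it is marked by `c`. -/
def Matched (c : Finset ℕ → Prop) (S T : Set ℕ) : Prop :=
  (∀ i ∈ S, (c (seg S i) ↔ i ∈ T)) ∧ ∀ i ∈ T, (c (seg T i) ↔ i ∈ S)

/-- For predictable families one finds two sets such that, up to exchanging them, the finite set
attached to the first one is contained in the second one, and their intersection is contained in
both attached finite sets. -/
theorem exists_matching {F : InfSubset → Finset ℕ} (hF : IsLocallyConstant F)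
    (hFM : ∀ M, ∀ i ∈ F M, i ∈ M.1) :
    ∃ L M : InfSubset, (∀ i ∈ F L, i ∈ M.1) ∧ ∀ i, i ∈ L.1 → i ∈ M.1 → i ∈ F L ∧ i ∈ F M := by
  classical
  obtain ⟨φ, c, hφ, hc⟩ := exists_subseq_predict hF
  -- a matched pair, the first member of which determines its attached set, suffices
  have key : ∀ (S T : Set ℕ) (j : ℕ) (L₀ : InfSubset), S ⊆ Set.range φ → T ⊆ Set.range φ →
      (∀ i ∈ S, i < φ j) → (∀ i ∈ T, i < φ j) → Matched c S T →
      (∀ L : InfSubset, (∀ i < φ j, (i ∈ L.1 ↔ i ∈ S)) → F L = F L₀) →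
      ∃ L M : InfSubset, (∀ i ∈ F L, i ∈ M.1) ∧
        ∀ i, i ∈ L.1 → i ∈ M.1 → i ∈ F L ∧ i ∈ F M := by
    intro S T j L₀ hS hT hSj hTj hST hdec
    -- The parities `p = 0` and `p = 1` give disjoint tails above `φ j`, so two such extensions meet
    -- only in their finite parts.
    let ext (R : Set ℕ) (p : ℕ) : InfSubset := ⟨R ∪ Set.range fun k => φ (j + 2 * k + p),
      (Set.infinite_range_of_injective fun k l hkl => by
        have := hφ.injective hkl
        omega).mono Set.subset_union_right⟩
    have hge : ∀ k p, φ j ≤ φ (j + 2 * k + p) := fun k p => hφ.monotone (by omega)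
    have hext : ∀ (R : Set ℕ) p, ∀ i < φ j, (i ∈ (ext R p).1 ↔ i ∈ R) := by
      intro R p i hi
      refine ⟨?_, Or.inl⟩
      rintro (h | ⟨k, rfl⟩)
      · exact h
      · exact absurd hi (not_lt.2 (hge k p))
    have hextφ : ∀ (R : Set ℕ) p, R ⊆ Set.range φ → (ext R p).1 ⊆ Set.range φ := by
      rintro R p hR i (h | ⟨k, rfl⟩)
      · exact hR h
      · exact ⟨_, rfl⟩
    have hseg : ∀ (R : Set ℕ) p, ∀ i < φ j, seg (ext R p).1 i = seg R i := fun R p i hi =>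
      seg_congr fun k hk => hext R p k (hk.trans hi)
    have hinter : ∀ (R R' : Set ℕ), (∀ i ∈ R, i < φ j) → (∀ i ∈ R', i < φ j) →
        ∀ i, i ∈ (ext R 0).1 → i ∈ (ext R' 1).1 → i ∈ R ∧ i ∈ R' := by
      rintro R R' hR hR' i (h | ⟨k, rfl⟩) (h' | ⟨l, hl⟩)
      · exact ⟨h, h'⟩
      · subst hl
        exact absurd (hR _ h) (not_lt.2 (hge l 1))
      · exact absurd (hR' _ h') (not_lt.2 (hge k 0))
      · have := hφ.injective hl
        omega
    refine ⟨ext S 0, ext T 1, fun i hi => Or.inl ?_, fun i hi hi' => ?_⟩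
    · have h0 : i ∈ (ext S 0).1 := hFM _ i hi
      -- Both extensions of `S` have the same attached set, which therefore lies in their
      -- intersection `S`.
      have h1 : i ∈ (ext S 1).1 := hFM _ i (by
        rwa [hdec _ (hext S 1), ← hdec _ (hext S 0)])
      have hiS : i ∈ S := (hinter S S hSj hSj i h0 h1).1
      rw [hc _ (hextφ S 0 hS) i h0, hseg S 0 i (hSj i hiS)] at hi
      exact (hST.1 i hiS).1 hi
    · obtain ⟨hiS, hiT⟩ := hinter S T hSj hTj i hi hi'
      rw [hc _ (hextφ S 0 hS) i hi, hc _ (hextφ T 1 hT) i hi', hseg S 0 i (hSj i hiS),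
        hseg T 1 i (hTj i hiT)]
      exact ⟨(hST.1 i hiS).2 hiT, (hST.2 i hiT).2 hiS⟩
  -- construct the pair step by step
  let next : Finset ℕ × Finset ℕ → ℕ → Finset ℕ × Finset ℕ := fun p m =>
    if c p.1 then if c p.2 then (insert m p.1, insert m p.2) else (p.1, insert m p.2)
    else (insert m p.1, p.2)
  let R : ℕ → Finset ℕ × Finset ℕ := fun n => Nat.rec (∅, ∅) (fun j p => next p (φ j)) n
  have hR : ∀ j, R (j + 1) = next (R j) (φ j) := fun j => rfl
  have hlt : ∀ j, (∀ i ∈ (R j).1, ∃ k < j, φ k = i) ∧ ∀ i ∈ (R j).2, ∃ k < j, φ k = i := by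
    intro j
    induction j with
    | zero => simp [R]
    | succ j ih =>
      rw [hR]
      have h1 : ∀ i ∈ (R j).1, ∃ k < j + 1, φ k = i := fun i hi =>
        (ih.1 i hi).imp fun k hk => ⟨hk.1.trans j.lt_succ_self, hk.2⟩
      have h2 : ∀ i ∈ (R j).2, ∃ k < j + 1, φ k = i := fun i hi =>
        (ih.2 i hi).imp fun k hk => ⟨hk.1.trans j.lt_succ_self, hk.2⟩
      have h3 : ∃ k < j + 1, φ k = φ j := ⟨j, j.lt_succ_self, rfl⟩
      simp only [next]
      split_ifs <;> simp only [Finset.mem_insert, forall_eq_or_imp] <;> tauto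
  have hlt1 : ∀ j, ∀ i ∈ (R j).1, i < φ j := fun j i hi => by
    obtain ⟨k, hk, rfl⟩ := (hlt j).1 i hi
    exact hφ hk
  have hlt2 : ∀ j, ∀ i ∈ (R j).2, i < φ j := fun j i hi => by
    obtain ⟨k, hk, rfl⟩ := (hlt j).2 i hi
    exact hφ hk
  have hsegle : ∀ (s : Finset ℕ) (m : ℕ), (∀ i ∈ s, i < m) → ∀ t : Finset ℕ,
      (t = s ∨ t = insert m s) → seg (t : Set ℕ) m = s := by
    rintro s m hs t (rfl | rfl) <;> ext i <;> rw [mem_seg] <;> simp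
    · exact hs i
    · constructor
      · rintro ⟨h1, rfl | h2⟩
        · exact absurd h1 (lt_irrefl _)
        · exact h2
      · exact fun h => ⟨hs i h, Or.inr h⟩
  have hsegle' : ∀ (s : Finset ℕ) (m i : ℕ), i ≤ m → seg (insert m s : Set ℕ) i = seg (s : Set ℕ) i := by
    intro s m i hi
    refine seg_congr fun k hk => ?_
    rw [Set.mem_insert_iff, or_iff_right (hk.trans_le hi).ne]
  -- A new point enters both sets exactly when both are marked. Otherwise it enters one unmarked set
  -- only, where its absence from the other set is what matching requires. Later points do not
  -- affect the segments below earlier ones.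
  have hmatch : ∀ j, Matched c (R j).1 (R j).2 := by
    intro j
    induction j with
    | zero => simp [R, Matched]
    | succ j ih =>
      have hn1 : φ j ∉ (R j).1 := fun h => lt_irrefl _ (hlt1 j _ h)
      have hn2 : φ j ∉ (R j).2 := fun h => lt_irrefl _ (hlt2 j _ h)
      have hs1 : seg ((R j).1 : Set ℕ) (φ j) = (R j).1 := hsegle _ _ (hlt1 j) _ (Or.inl rfl)
      have hs2 : seg ((R j).2 : Set ℕ) (φ j) = (R j).2 := hsegle _ _ (hlt2 j) _ (Or.inl rfl)
      have ho1 : ∀ i ∈ (R j).1, seg (insert (φ j) (R j).1 : Set ℕ) i = seg ((R j).1 : Set ℕ) i :=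
        fun i hi => hsegle' _ _ _ (hlt1 j i hi).le
      have ho2 : ∀ i ∈ (R j).2, seg (insert (φ j) (R j).2 : Set ℕ) i = seg ((R j).2 : Set ℕ) i :=
        fun i hi => hsegle' _ _ _ (hlt2 j i hi).le
      have hne1 : ∀ i ∈ (R j).1, i ≠ φ j := fun i hi => (hlt1 j i hi).ne
      have hne2 : ∀ i ∈ (R j).2, i ≠ φ j := fun i hi => (hlt2 j i hi).ne
      obtain ⟨ih1, ih2⟩ := ih
      simp only [Finset.mem_coe] at ih1 ih2
      rw [hR]
      simp only [next]
      split_ifs with hc1 hc2 <;> constructor <;>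
        simp only [Finset.coe_insert, Set.mem_insert_iff, forall_eq_or_imp, Finset.mem_coe] <;>
        first
        | refine ⟨?_, fun i hi => ?_⟩
        | intro i hi
      · rw [hsegle' _ _ _ le_rfl, hs1]; simp [hc1]
      · rw [ho1 i hi, ih1 i hi]; simp [hne1 i hi]
      · rw [hsegle' _ _ _ le_rfl, hs2]; simp [hc2]
      · rw [ho2 i hi, ih2 i hi]; simp [hne2 i hi]
      · rw [ih1 i hi]; simp [hne1 i hi]
      · rw [hsegle' _ _ _ le_rfl, hs2]; simp [hc2, hn1]
      · rw [ho2 i hi, ih2 i hi]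
      · rw [hsegle' _ _ _ le_rfl, hs1]; simp [hc1, hn2]
      · rw [ho1 i hi, ih1 i hi]
      · rw [ih2 i hi]; simp [hne2 i hi]
  have hmono : ∀ j, (R j).1 ⊆ (R (j + 1)).1 ∧ (R j).2 ⊆ (R (j + 1)).2 := by
    intro j
    rw [hR]
    simp only [next]
    split_ifs <;> simp [Finset.subset_insert]
  have hgrow : ∀ j, φ j ∈ (R (j + 1)).1 ∨ φ j ∈ (R (j + 1)).2 := by
    intro j
    rw [hR]
    simp only [next]
    split_ifs <;> simp
  have hnew : ∀ j, (∀ i ∈ (R (j + 1)).1, i < φ j → i ∈ (R j).1) ∧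
      ∀ i ∈ (R (j + 1)).2, i < φ j → i ∈ (R j).2 := by
    intro j
    rw [hR]
    simp only [next]
    split_ifs <;> simp +contextual
  -- the union of one of the coordinates is infinite
  have hlim : ∀ S : ℕ → Finset ℕ, Monotone S → (∀ j, ∀ i ∈ S j, i < φ j) →
      (∀ j, ∀ i ∈ S (j + 1), i < φ j → i ∈ S j) → (⋃ j, (S j : Set ℕ)).Infinite →
      ∃ (j : ℕ) (L₀ : InfSubset),
        ∀ L : InfSubset, (∀ i < φ j, (i ∈ L.1 ↔ i ∈ (S j : Set ℕ))) → F L = F L₀ := by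
    intro S hS hSlt hSnew hinf
    obtain ⟨n, hn⟩ := isLocallyConstant_iff_infSubset.1 hF ⟨_, hinf⟩
    have hback : ∀ j k, ∀ i ∈ S (j + k), i < φ j → i ∈ S j := by
      intro j k
      induction k with
      | zero => exact fun i hi _ => hi
      | succ k ih =>
        intro i hi hij
        exact ih i (hSnew (j + k) i hi (hij.trans_le (hφ.monotone (by omega)))) hij
    refine ⟨n, ⟨_, hinf⟩, fun L hL => hn L fun i hi => ?_⟩
    rw [hL i (hi.trans_le hφ.le_apply), Set.mem_iUnion]
    refine ⟨fun h => ⟨n, h⟩, ?_⟩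
    rintro ⟨k, hk⟩
    exact hback n k i (hS (Nat.le_add_left k n) hk) (hi.trans_le hφ.le_apply)
  have hS1 : Monotone fun j => (R j).1 := monotone_nat_of_le_succ fun j => (hmono j).1
  have hS2 : Monotone fun j => (R j).2 := monotone_nat_of_le_succ fun j => (hmono j).2
  have hsub1 : ∀ j, ((R j).1 : Set ℕ) ⊆ Set.range φ := fun j i hi =>
    ((hlt j).1 i hi).imp fun _ h => h.2
  have hsub2 : ∀ j, ((R j).2 : Set ℕ) ⊆ Set.range φ := fun j i hi =>
    ((hlt j).2 i hi).imp fun _ h => h.2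
  have hinf : ((⋃ j, ((R j).1 : Set ℕ)) ∪ ⋃ j, ((R j).2 : Set ℕ)).Infinite := by
    refine (Set.infinite_range_of_injective hφ.injective).mono ?_
    rintro _ ⟨j, rfl⟩
    exact (hgrow j).imp (fun h => Set.mem_iUnion.2 ⟨j + 1, Finset.mem_coe.2 h⟩)
      fun h => Set.mem_iUnion.2 ⟨j + 1, Finset.mem_coe.2 h⟩
  -- Every `φ j` enters at least one coordinate, so one limit is infinite and a finite stage
  -- determines its attached set. Matching is symmetric, so that coordinate can play the role of the
  -- first.
  rcases Set.infinite_union.1 hinf with h | h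
  · obtain ⟨j, L₀, hj⟩ := hlim _ hS1 hlt1 (fun j => (hnew j).1) h
    exact key _ _ j L₀ (hsub1 j) (hsub2 j) (hlt1 j) (hlt2 j) (hmatch j) hj
  · obtain ⟨j, L₀, hj⟩ := hlim _ hS2 hlt2 (fun j => (hnew j).2) h
    exact key _ _ j L₀ (hsub2 j) (hsub1 j) (hlt2 j) (hlt1 j) ⟨(hmatch j).2, (hmatch j).1⟩ hj

/-- For a matched pair, `x*_L(x_M)` is at least `δ/2` times the witnessed sum of `L`, up to the
contribution of the indices off `L`, which is at most 1. It is also at most 1. -/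
theorem IsSelection.mul_le {δ ε C : ℝ} {x : ℕ → X} {w : InfSubset → WitnessData X}
    (h : IsSelection δ ε C x w) (hδ : 0 < δ) (hε1 : ε < 1) : δ * C ≤ 6 := by
  classical
  have hwit := h.isFinWitness
  have hF : ∀ M, ∀ i ∈ (w M).F, i ∈ (w M).a.support := fun M i hi => (hwit M).mem_support hδ hi
  have hle : ∀ M i, |(w M).a i| ≤ 2 := fun M i => by
    have := h.coeff_le (w M).a i
    rw [(hwit M).norm_comb] at this
    linarith
  obtain ⟨L, M, hLM, hinter⟩ := exists_matching (h.continuous.comp WitnessData.F)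
    fun M i hi => (hwit M).support_subset i (hF M i hi)
  simp only [Function.comp_apply] at hLM hinter
  set f := (w L).f
  have hval : f (comb x (w M).a) = ∑ i ∈ (w L).F, (w M).a i * f (x i) +
      ∑ i ∈ (w M).a.support with i ∉ L.1, (w M).a i * f (x i) := by
    have hfilter : (w L).F = (w M).a.support.filter (· ∈ L.1) := by
      ext i
      rw [Finset.mem_filter]
      constructor
      · intro hi
        have hiL := (hwit L).support_subset i (hF L i hi)
        exact ⟨hF M i (hinter i hiL (hLM i hi)).2, hiL⟩
      · rintro ⟨hi, hiL⟩
        exact (hinter i hiL ((hwit M).support_subset i hi)).1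
    rw [hfilter, Finset.sum_filter_add_sum_filter_not, comb, map_sum]
    simp
  -- On `F_L ⊆ F_M` the coefficients of `x_M` are at least `δ`, while those of `x_L` are at most 2.
  have h1 : δ / 2 * ∑ i ∈ (w L).F, (w L).a i * f (x i) ≤
      ∑ i ∈ (w L).F, (w M).a i * f (x i) := by
    rw [Finset.mul_sum]
    refine Finset.sum_le_sum fun i hi => ?_
    rw [← mul_assoc]
    refine mul_le_mul_of_nonneg_right ?_ ((hwit L).mem_F i hi).2.le
    have hiL := (hwit L).support_subset i (hF L i hi)
    have h2 := ((hwit M).mem_F i (hinter i hiL (hLM i hi)).2).1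
    have h3 := (le_abs_self _).trans (hle L i)
    nlinarith
  have h2 : |∑ i ∈ (w M).a.support with i ∉ L.1, (w M).a i * f (x i)| ≤ 1 := by
    calc |∑ i ∈ (w M).a.support with i ∉ L.1, (w M).a i * f (x i)|
        ≤ ∑ i ∈ (w M).a.support with i ∉ L.1, |(w M).a i * f (x i)| :=
          Finset.abs_sum_le_sum_abs _ _
      _ ≤ ∑ i ∈ (w M).a.support with i ∉ L.1, 2 * |f (x i)| := by
          refine Finset.sum_le_sum fun i _ => ?_
          rw [abs_mul]
          exact mul_le_mul_of_nonneg_right (hle M i) (abs_nonneg _)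
      _ = 2 * ∑ i ∈ (w M).a.support with i ∉ L.1, |f (x i)| := by rw [Finset.mul_sum]
      _ ≤ 2 * (ε / 2) := by
          gcongr
          exact h.sum_le L _ fun i hi => (Finset.mem_filter.1 hi).2
      _ ≤ 1 := by linarith
  have h3 := abs_apply_le (hwit L).norm_f_le (comb x (w M).a)
  rw [(hwit M).norm_comb] at h3
  have h4 := (abs_le.1 h3).2
  have h5 := (abs_le.1 h2).1
  have h6 := (hwit L).lt_sum
  change f (comb x (w M).a) ≤ 1 at h4
  have h7 : δ / 2 * C ≤ δ / 2 * ∑ i ∈ (w L).F, (w L).a i * f (x i) :=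
    mul_le_mul_of_nonneg_left h6.le (by positivity)
  linarith

/-- Elton's theorem: nearly unconditional subsequences exist, with constants depending only on the
lower bound for the coefficients. -/
theorem kPrime_lt_top {δ : ℝ} (hδ : 0 < δ) : kPrime.{u} δ < ⊤ := by
  by_contra htop
  -- Sign splitting halves `14 / δ`, so the selection would give `7 ≤ 6`.
  have hlt : ((14 / δ).toNNReal : ℝ≥0∞) < kPrime.{u} δ := by
    rw [not_lt_top_iff.1 htop]
    exact ENNReal.coe_lt_top
  obtain ⟨X, _, _, _, x, w, hw⟩ := exists_isSelection (ε := 1 / 2) hδ (by norm_num) (by norm_num) hlt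
  have := hw.mul_le hδ (by norm_num)
  rw [Real.coe_toNNReal _ (by positivity)] at this
  have h2 : δ * (14 / δ / 2) = 7 := by field_simp; norm_num
  linarith

/-! ### Bounding the constants by matching -/

theorem vec_eq_comb {w : WitnessData X} {M : InfSubset} (h : ∀ i ∈ w.a.support, i ∈ M.1)
    (x : ℕ → X) : w.vec x M = comb x w.a := by
  classical
  rw [WitnessData.vec, Finset.filter_true_of_mem h, comb]

theorem tsum_ofReal_abs_lt {ε : ℝ} (hε : 0 < ε) {g : ℕ → ℝ} {A : Set ℕ}
    (h : ∀ S : Finset ℕ, (∀ i ∈ S, i ∈ A) → ∑ i ∈ S, |g i| ≤ ε / 2) :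
    ∑' i : A, ENNReal.ofReal |g i| < ENNReal.ofReal ε := by
  refine lt_of_le_of_lt (b := ENNReal.ofReal (ε / 2)) ?_
    ((ENNReal.ofReal_lt_ofReal_iff hε).2 (by linarith))
  rw [ENNReal.tsum_eq_iSup_sum]
  refine iSup_le fun S => ?_
  rw [← ENNReal.ofReal_sum_of_nonneg fun _ _ => abs_nonneg _]
  refine ENNReal.ofReal_le_ofReal ?_
  have := h (S.map (Function.Embedding.subtype _)) (by simp +contextual)
  rwa [Finset.sum_map] at this

theorem IsSelection.isStableSelection {δ ε : ℝ} {C : ℝ≥0} {x : ℕ → X}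
    {w : InfSubset → WitnessData X} (h : IsSelection δ ε (C / 2) x w) (hδ : 0 < δ) (hε : 0 < ε)
    (hC : kPrime.{u} δ = 2 * C) : IsStableSelection δ ε x w where
  normalizedWeaklyNull := h.normalizedWeaklyNull
  basic := h.basic
  coeff_le := h.coeff_le
  isWitness M :=
    { norm_f_le := (h.isFinWitness M).norm_f_le
      F_subset := fun i hi => ⟨(h.isFinWitness M).support_subset i
        ((h.isFinWitness M).mem_support hδ hi), (h.isFinWitness M).mem_F i hi⟩
      norm_vec := by
        rw [vec_eq_comb (h.isFinWitness M).support_subset]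
        exact (h.isFinWitness M).norm_comb
      lt_sum := by
        have h1 : kPrime.{u} δ / 4 = ENNReal.ofReal (C / 2) := by
          rw [hC, ENNReal.ofReal_div_of_pos two_pos, ENNReal.ofReal_coe_nnreal]
          rw [show (4 : ℝ≥0∞) = 2 * 2 by norm_num,
            ENNReal.mul_div_mul_left _ _ (by norm_num) (by norm_num)]
          norm_num
        rw [h1]
        have h2 := (h.isFinWitness M).lt_sum
        exact (ENNReal.ofReal_lt_ofReal_iff (lt_of_le_of_lt (by positivity) h2)).2 h2 }
  continuous := h.continuous
  support_lt M := tsum_ofReal_abs_lt (A := {i | i ∉ M.1}) hε (h.sum_le M)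

theorem kPrime_le_of_matchingProperty {c δ ε : ℝ} (hδ : 0 < δ) (hε : 0 < ε)
    (hε1 : ε < 1) (h : MatchingProperty.{u} c δ ε) : kPrime.{u} δ ≤ (ENNReal.ofReal c)⁻¹ := by
  rcases eq_or_ne (kPrime.{u} δ) 0 with h0 | h0
  · simp [h0]
  obtain ⟨K, hK⟩ : ∃ K : ℝ≥0, (K : ℝ≥0∞) = kPrime.{u} δ :=
    ⟨_, ENNReal.coe_toNNReal (kPrime_lt_top.{u} hδ).ne⟩
  have hK0 : K ≠ 0 := by
    rintro rfl
    exact h0 (by simp [← hK])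
  -- Half of a finite non-zero constant lies strictly below it. Sign splitting halves it again,
  -- which gives the threshold `K'(δ)/4`.
  have hlt : ((K / 2 : ℝ≥0) : ℝ≥0∞) < kPrime.{u} δ := by
    rw [← hK, ENNReal.coe_lt_coe]
    exact NNReal.half_lt_self hK0
  obtain ⟨X, _, _, _, x, w, hw⟩ := exists_isSelection hδ hε hε1 hlt
  have hst : IsStableSelection δ ε x w := hw.isStableSelection hδ hε (by
    rw [← hK, ← ENNReal.coe_ofNat, ← ENNReal.coe_mul, mul_div_cancel₀ _ two_ne_zero])
  obtain ⟨L, M, hLM⟩ := h X x w hst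
  rw [ENNReal.le_inv_iff_mul_le, mul_comm]
  refine hLM.trans (ENNReal.ofReal_le_one.2 ?_)
  have := abs_apply_le (hst.isWitness L).norm_f_le ((w M).vec x M)
  rwa [(hst.isWitness M).norm_vec] at this

theorem exists_admissible {δ : ℝ} (hδ : 0 < δ) : ∃ ε, Admissible δ ε := by
  have h1 : 1 < 2 ^ (⌊Real.logb 2 (1 / δ)⌋₊ + 1) * δ := by
    have h2 := Nat.lt_floor_add_one (Real.logb 2 (1 / δ))
    rw [Real.logb_lt_iff_lt_rpow one_lt_two (by positivity)] at h2
    rw [← div_lt_iff₀ hδ]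
    exact_mod_cast h2
  refine ⟨min (1 / 2) ((2 ^ (⌊Real.logb 2 (1 / δ)⌋₊ + 1) * δ - 1) / 2), lt_min (by norm_num)
    (by linarith), (min_le_left _ _).trans_lt (by norm_num), ?_⟩
  have := min_le_right (1 / 2) ((2 ^ (⌊Real.logb 2 (1 / δ)⌋₊ + 1) * δ - 1) / 2)
  linarith

/-! ### Renorming by the functionals of a selection -/

theorem exists_coord {x : ℕ → X} {C : ℝ} (hC : 0 ≤ C)
    (h : ∀ (a : ℕ →₀ ℝ) (i : ℕ), |a i| ≤ C * ‖comb x a‖) (i : ℕ) :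
    ∃ g : StrongDual ℝ X, ‖g‖ ≤ C ∧ ∀ a, g (comb x a) = a i := by
  have hli : LinearIndependent ℝ x := by
    rw [linearIndependent_iff]
    intro a ha
    ext j
    have := h a j
    rw [comb_eq_linearCombination, ha, norm_zero, mul_zero] at this
    simpa using this
  let g₀ : Submodule.span ℝ (Set.range x) →ₗ[ℝ] ℝ := Finsupp.lapply i ∘ₗ hli.repr
  have hg₀ : ∀ v, ‖g₀ v‖ ≤ C * ‖v‖ := by
    intro v
    have := h (hli.repr v) i
    rwa [comb_eq_linearCombination, hli.linearCombination_repr] at this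
  obtain ⟨g, hg, hgn⟩ := exists_extension_norm_eq _ (g₀.mkContinuous C hg₀)
  refine ⟨g, hgn.trans_le (g₀.mkContinuous_norm_le hC hg₀), fun a => ?_⟩
  have hmem : comb x a ∈ Submodule.span ℝ (Set.range x) := by
    rw [comb_eq_linearCombination]
    exact Finsupp.mem_span_range_iff_exists_finsupp.2 ⟨a, rfl⟩
  refine (hg ⟨_, hmem⟩).trans ?_
  change hli.repr ⟨comb x a, hmem⟩ i = a i
  rw [hli.repr_eq (l := a) rfl]

/-- Realizes a supremum of functionals as the norm of a complete space, without forming a quotient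
or completion. -/
theorem exists_continuousLinearMap_lp {ι : Type u} (G : ι → StrongDual ℝ X) {C : ℝ}
    (hG : ∀ i, ‖G i‖ ≤ C) :
    ∃ T : X →L[ℝ] lp (fun _ : ι => ℝ) ∞, ∀ v i, T v i = G i v := by
  have hb : ∀ v i, ‖G i v‖ ≤ max C 0 * ‖v‖ := fun v i =>
    (G i).le_of_opNorm_le ((hG i).trans (le_max_left _ _)) v
  let T₀ : X →ₗ[ℝ] lp (fun _ : ι => ℝ) ∞ :=
    { toFun := fun v => ⟨fun i => G i v, memℓp_infty ⟨max C 0 * ‖v‖, by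
        rintro _ ⟨i, rfl⟩
        exact hb v i⟩⟩
      map_add' := fun v v' => by ext i; exact map_add (G i) v v'
      map_smul' := fun r v => by ext i; exact map_smul (G i) r v }
  exact ⟨T₀.mkContinuous (max C 0) fun v =>
    lp.norm_le_of_forall_le (by positivity) fun i => hb v i, fun v i => rfl⟩

theorem one_le_kPrime [CompleteSpace X] {x : ℕ → X} (hx : NormalizedWeaklyNull x) {δ : ℝ}
    (hδ : δ ≤ 1) : 1 ≤ kPrime.{u} δ := by
  have h1 : 1 ≤ ⨅ (φ : ℕ → ℕ) (_ : StrictMono φ), kPrimeSeq (x ∘ φ) δ := by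
    refine le_iInf₂ fun φ _ => le_iInf₂ fun C hC => ?_
    have := hC (Finsupp.single 0 1) {0} (by simpa using hδ) (by
      rw [comb_single]; simp [hx.norm_eq_one])
    rw [comb_single] at this
    simp only [Finset.sum_singleton, Finsupp.single_eq_same, one_smul, Function.comp_apply,
      hx.norm_eq_one, mul_one] at this
    exact_mod_cast this
  refine h1.trans ?_
  rw [kPrime]
  refine le_iSup_of_le X (le_iSup_of_le ‹_› (le_iSup_of_le ‹_› (le_iSup_of_le ‹_› ?_)))
  exact le_iSup₂_of_le x hx le_rfl

theorem normalizedWeaklyNull_map {Y : Type u} [NormedAddCommGroup Y] [NormedSpace ℝ Y]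
    {x : ℕ → X} (hx : NormalizedWeaklyNull x) (T : X →L[ℝ] Y) {θ : ℝ} (hθ : 0 < θ)
    (hT : ∀ i, θ ≤ ‖T (x i)‖) : NormalizedWeaklyNull fun i => ‖T (x i)‖⁻¹ • T (x i) := by
  refine ⟨fun i => ?_, fun f => ?_⟩
  · rw [norm_smul, norm_inv, norm_norm]
    exact inv_mul_cancel₀ (hθ.trans_le (hT i)).ne'
  · have h1 := ((hx.weakly_null (f.comp T)).norm).const_mul θ⁻¹
    rw [norm_zero, mul_zero] at h1
    refine squeeze_zero_norm (fun i => ?_) h1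
    rw [map_smul, norm_smul, norm_inv, norm_norm]
    exact mul_le_mul_of_nonneg_right (inv_anti₀ hθ (hT i)) (norm_nonneg _)

/-- If the functionals of a selection are small on all vectors of the selection, then the
renorming by these functionals produces a sequence whose constant is large. -/
theorem le_kPrime_half [CompleteSpace X] {δ ε θ : ℝ} {x : ℕ → X}
    {w : InfSubset → WitnessData X} (h : IsStableSelection δ ε x w) (hδ : 0 < δ) (hδ1 : δ ≤ 1)
    (hε : 0 < ε) (hε1 : ε < 1) (hθ : 0 < θ) (hθ1 : θ ≤ 1)
    (hsmall : ∀ L M : InfSubset, |(w L).f ((w M).vec x M)| ≤ 2 * θ) :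
    ENNReal.ofReal (1 / (8 * θ)) ≤ kPrime.{u} (δ / 2) := by
  classical
  choose e he1 he using exists_coord (by linarith) h.coeff_le
  -- The coordinate functionals, scaled by `θ`, keep the images of the `x i` bounded away from 0, so
  -- that they can be normalized.
  let G : ULift.{u} (ℕ ⊕ InfSubset) → StrongDual ℝ X := fun i =>
    i.down.elim (fun i => θ • e i) fun L => (w L).f
  have hG : ∀ i, ‖G i‖ ≤ 2 := by
    rintro ⟨i | L⟩
    · change ‖θ • e i‖ ≤ 2
      rw [norm_smul, Real.norm_of_nonneg hθ.le]
      nlinarith [he1 i, norm_nonneg (e i)]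
    · exact (h.isWitness L).norm_f_le.trans one_le_two
  obtain ⟨T, hT⟩ := exists_continuousLinearMap_lp G hG
  have hTe : ∀ v i, |θ * e i v| ≤ ‖T v‖ := fun v i => by
    have := lp.norm_apply_le_norm ENNReal.top_ne_zero (T v) ⟨Sum.inl i⟩
    rwa [hT] at this
  have hTf : ∀ v L, |(w L).f v| ≤ ‖T v‖ := fun v L => by
    have := lp.norm_apply_le_norm ENNReal.top_ne_zero (T v) ⟨Sum.inr L⟩
    rwa [hT] at this
  have hTx : ∀ i, θ ≤ ‖T (x i)‖ := fun i => by
    have h1 := he i (Finsupp.single i 1)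
    rw [comb_single, one_smul, Finsupp.single_eq_same] at h1
    have h2 := hTe (x i) i
    rwa [h1, mul_one, abs_of_pos hθ] at h2
  set r : ℕ → ℝ := fun i => ‖T (x i)‖
  have hr : ∀ i, 0 < r i := fun i => hθ.trans_le (hTx i)
  set y : ℕ → lp (fun _ : ULift.{u} (ℕ ⊕ InfSubset) => ℝ) ∞ := fun i => (r i)⁻¹ • T (x i)
  have hy : NormalizedWeaklyNull y := normalizedWeaklyNull_map h.normalizedWeaklyNull T hθ hTx
  have hmain : ∀ φ : ℕ → ℕ, StrictMono φ →
      ENNReal.ofReal (1 / (8 * θ)) ≤ kPrimeSeq (y ∘ φ) (δ / 2) := by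
    intro φ hφ
    -- Each subsequence is tested with the witness of its own index set. Coefficients outside `M` do
    -- not enter `x_M` and are removed.
    let M : InfSubset := ⟨Set.range φ, Set.infinite_range_of_injective hφ.injective⟩
    set a : ℕ →₀ ℝ := (w M).a.filter (· ∈ M.1)
    have hvec : (w M).vec x M = comb x a := by
      rw [WitnessData.vec, comb, Finsupp.support_filter]
      refine Finset.sum_congr (by congr) fun i hi => ?_
      rw [Finsupp.filter_apply_pos _ _ (Finset.mem_filter.1 hi).2]
    have hnorm : ‖comb x a‖ = 1 := hvec ▸ (h.isWitness M).norm_vec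
    have hF : ∀ i ∈ (w M).F, i ∈ M.1 ∧ a i = (w M).a i := fun i hi => by
      have := ((h.isWitness M).F_subset i hi).1
      exact ⟨this, Finsupp.filter_apply_pos _ _ this⟩
    -- The coefficients of `(2θ)⁻¹ T x_M` in terms of the normalized `y i`. On `F_M` they are at
    -- least `(2θ)⁻¹ δ θ = δ / 2`.
    let b : ℕ →₀ ℝ := Finsupp.onFinset a.support (fun i => (2 * θ)⁻¹ * (a i * r i)) fun i hi => by
      rw [Finsupp.mem_support_iff]
      rintro h0
      simp [h0] at hi
    have hby : ∀ i, b i • y i = (2 * θ)⁻¹ • a i • T (x i) := fun i => by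
      change ((2 * θ)⁻¹ * (a i * r i)) • (r i)⁻¹ • T (x i) = _
      rw [smul_smul, smul_smul, mul_assoc, mul_assoc, mul_inv_cancel₀ (hr i).ne', mul_one]
    have hsum : ∀ S : Finset ℕ, ∑ i ∈ S, b i • y i = (2 * θ)⁻¹ • T (∑ i ∈ S, a i • x i) := by
      intro S
      rw [map_sum, Finset.smul_sum]
      exact Finset.sum_congr rfl fun i _ => by rw [hby, map_smul]
    have hbsupp : b.support ⊆ a.support := Finsupp.support_onFinset_subset
    have hbM : ∀ i ∈ b.support, i ∈ Set.range φ := fun i hi =>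
      (Finset.mem_filter.1 (Finsupp.support_filter (· ∈ M.1) (w M).a ▸ hbsupp hi)).2
    -- Coordinates of `x_M` are at most `1 + ε ≤ 2` in modulus, so the scaled coordinate functionals
    -- obey the same bound `2θ` as the functionals `x*_L`.
    have hTv : ‖T (comb x a)‖ ≤ 2 * θ := by
      refine lp.norm_le_of_forall_le (by positivity) ?_
      rintro ⟨i | L⟩
      · rw [hT]
        change |θ * e i (comb x a)| ≤ 2 * θ
        rw [he, abs_mul, abs_of_pos hθ]
        have := h.coeff_le a i
        rw [hnorm] at this
        nlinarith
      · rw [hT]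
        change |(w L).f (comb x a)| ≤ 2 * θ
        exact hvec ▸ hsmall L M
    have hcomb : comb (y ∘ φ) (b.comapDomain φ hφ.injective.injOn) =
        (2 * θ)⁻¹ • T (comb x a) := by
      rw [comb_comp, Finsupp.mapDomain_comapDomain φ hφ.injective b hbM, comb_eq_sum y hbsupp, hsum]
      rfl
    have hcomb1 : ‖comb (y ∘ φ) (b.comapDomain φ hφ.injective.injOn)‖ ≤ 1 := by
      rw [hcomb, norm_smul, norm_inv, Real.norm_of_nonneg (by positivity),
        inv_mul_le_iff₀ (by positivity), mul_one]
      exact hTv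
    refine le_iInf₂ fun C hC => ?_
    have hCle := hC (b.comapDomain φ hφ.injective.injOn)
      ((w M).F.preimage φ hφ.injective.injOn) (fun j hj => ?_) hcomb1
    · have hE : ∑ j ∈ (w M).F.preimage φ hφ.injective.injOn,
          (b.comapDomain φ hφ.injective.injOn) j • (y ∘ φ) j =
            (2 * θ)⁻¹ • T (∑ i ∈ (w M).F, (w M).a i • x i) := by
        rw [show ∑ i ∈ (w M).F, (w M).a i • x i = ∑ i ∈ (w M).F, a i • x i from
          Finset.sum_congr rfl fun i hi => by rw [(hF i hi).2], ← hsum]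
        exact Finset.sum_preimage φ (w M).F hφ.injective.injOn (fun i => b i • y i)
          fun i hi hi' => absurd (hF i hi).1 hi'
      have hlow : 1 / 4 ≤ ‖T (∑ i ∈ (w M).F, (w M).a i • x i)‖ := by
        refine le_trans ?_ ((le_abs_self _).trans (hTf _ M))
        have h1 := (h.isWitness M).lt_sum
        have h2 : ENNReal.ofReal (1 / 4) ≤ kPrime.{u} δ / 4 := by
          rw [ENNReal.ofReal_div_of_pos (by norm_num)]
          simpa using ENNReal.div_le_div_right (one_le_kPrime h.normalizedWeaklyNull hδ1) 4
        have h3 := (ENNReal.ofReal_lt_ofReal_iff_of_nonneg (by norm_num)).1 (h2.trans_lt h1)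
        simpa using h3.le
      rw [hE, norm_smul, norm_inv, Real.norm_of_nonneg (by positivity : (0 : ℝ) ≤ 2 * θ)] at hCle
      have h4 : (C : ℝ) * ‖comb (y ∘ φ) (b.comapDomain φ hφ.injective.injOn)‖ ≤ C :=
        mul_le_of_le_one_right C.2 hcomb1
      have h5 : 1 / (8 * θ) = (2 * θ)⁻¹ * (1 / 4) := by field_simp; norm_num
      have h6 : 1 / (8 * θ) ≤ C := by
        rw [h5]
        exact (mul_le_mul_of_nonneg_left hlow (by positivity)).trans (hCle.trans h4)
      rw [← ENNReal.ofReal_coe_nnreal]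
      exact ENNReal.ofReal_le_ofReal h6
    · have hj' : φ j ∈ (w M).F := by simpa using hj
      change δ / 2 ≤ |(2 * θ)⁻¹ * (a (φ j) * r (φ j))|
      rw [(hF _ hj').2]
      refine le_trans ?_ (le_abs_self _)
      have h1 := ((h.isWitness M).F_subset _ hj').2.1
      have h2 : δ * θ ≤ (w M).a (φ j) * r (φ j) :=
        mul_le_mul h1 (hTx _) hθ.le (hδ.le.trans h1)
      calc δ / 2 = (2 * θ)⁻¹ * (δ * θ) := by field_simp
        _ ≤ _ := mul_le_mul_of_nonneg_left h2 (by positivity)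
  rw [kPrime]
  refine le_iSup_of_le _ (le_iSup_of_le inferInstance (le_iSup_of_le inferInstance
    (le_iSup_of_le inferInstance (le_iSup₂_of_le y hy (le_iInf₂ hmain)))))

/-! ### The two implications -/

theorem exists_matchingProperty (h : (⨆ δ ∈ Set.Ioc (0 : ℝ) 1, kPrime.{u} δ) < ⊤) :
    ∃ c : ℝ, 0 < c ∧ ∀ δ ∈ Set.Ioc (0 : ℝ) 1, ∀ ε : ℝ, Admissible δ ε →
      MatchingProperty.{u} c δ ε := by
  set s := ⨆ δ ∈ Set.Ioc (0 : ℝ) 1, kPrime.{u} δ with hs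
  set K : ℝ := max 1 s.toReal with hK
  have hK1 : 1 ≤ K := le_max_left _ _
  have hle : ∀ δ ∈ Set.Ioc (0 : ℝ) 1, kPrime.{u} δ ≤ ENNReal.ofReal K := fun δ hδ => by
    have h1 : kPrime.{u} δ ≤ s := le_iSup₂ (f := fun δ (_ : δ ∈ Set.Ioc (0 : ℝ) 1) => kPrime.{u} δ) δ hδ
    refine h1.trans ?_
    rw [← ENNReal.ofReal_toReal h.ne]
    exact ENNReal.ofReal_le_ofReal (le_max_right _ _)
  -- Chosen so that `1 / (8θ) = 2K` exceeds the bound `K` for `K'(δ/2)`. With `c = 2θ / K`, failure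
  -- of matching gives `|x*_L(x_M)| < c K'(δ) ≤ 2θ`.
  set θ : ℝ := 1 / (16 * K) with hθ
  have hθ0 : 0 < θ := by positivity
  have hθ1 : θ ≤ 1 := by
    rw [hθ, div_le_one (by positivity)]
    linarith
  refine ⟨2 * θ / K, by positivity, fun δ hδ ε hε => ?_⟩
  intro X _ _ _ x w hw
  by_contra! hcon
  have hsmall : ∀ L M : InfSubset, |(w L).f ((w M).vec x M)| ≤ 2 * θ := by
    intro L M
    have h1 := (hcon L M).le.trans (mul_le_mul_right (hle δ hδ) (ENNReal.ofReal (2 * θ / K)))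
    rw [← ENNReal.ofReal_mul (by positivity), div_mul_cancel₀ _ (by positivity),
      ENNReal.ofReal_le_ofReal_iff (by positivity)] at h1
    exact h1
  have h1 := le_kPrime_half hw hδ.1 hδ.2 hε.1 hε.2.1 hθ0 hθ1 hsmall
  have h2 := h1.trans (hle (δ / 2) ⟨half_pos hδ.1, by linarith [hδ.2]⟩)
  rw [ENNReal.ofReal_le_ofReal_iff (by positivity)] at h2
  have h3 : 1 / (8 * θ) = 2 * K := by
    rw [hθ]
    field_simp
    norm_num
  linarith

theorem iSup_kPrime_lt_top {c : ℝ} (hc : 0 < c)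
    (h : ∀ δ ∈ Set.Ioc (0 : ℝ) 1, ∃ ε : ℝ, Admissible δ ε ∧ MatchingProperty.{u} c δ ε) :
    (⨆ δ ∈ Set.Ioc (0 : ℝ) 1, kPrime.{u} δ) < ⊤ := by
  refine lt_of_le_of_lt (iSup₂_le fun δ hδ => ?_)
    (ENNReal.inv_lt_top.2 (ENNReal.ofReal_pos.2 hc))
  obtain ⟨ε, hε, hm⟩ := h δ hδ
  exact kPrime_le_of_matchingProperty hδ.1 hε.1 hε.2.1 hm

end NearUnc

universe u in
/-- The parameter `ε` is chosen subject to constraints given by `δ`. The characterization holds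
for any way of choosing it: the condition for all admissible `ε` (with one constant `c`) is
necessary, and the condition for just one admissible `ε` for each `δ` is sufficient. -/
theorem proposition7p1 :
    ((⨆ δ ∈ Set.Ioc (0 : ℝ) 1, NearUnc.kPrime.{u} δ) < ⊤ ↔
      ∃ c : ℝ, 0 < c ∧ ∀ δ ∈ Set.Ioc (0 : ℝ) 1, ∀ ε : ℝ, NearUnc.Admissible δ ε →
        NearUnc.MatchingProperty.{u} c δ ε) ∧
    ((⨆ δ ∈ Set.Ioc (0 : ℝ) 1, NearUnc.kPrime.{u} δ) < ⊤ ↔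
      ∃ c : ℝ, 0 < c ∧ ∀ δ ∈ Set.Ioc (0 : ℝ) 1, ∃ ε : ℝ, NearUnc.Admissible δ ε ∧
        NearUnc.MatchingProperty.{u} c δ ε) := by
  have hall : ∀ {c : ℝ}, (∀ δ ∈ Set.Ioc (0 : ℝ) 1, ∀ ε : ℝ, NearUnc.Admissible δ ε →
      NearUnc.MatchingProperty.{u} c δ ε) → ∀ δ ∈ Set.Ioc (0 : ℝ) 1, ∃ ε : ℝ,
        NearUnc.Admissible δ ε ∧ NearUnc.MatchingProperty.{u} c δ ε := fun h δ hδ =>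
    (NearUnc.exists_admissible hδ.1).imp fun ε hε => ⟨hε, h δ hδ ε hε⟩
  refine ⟨⟨NearUnc.exists_matchingProperty, fun ⟨c, hc, h⟩ =>
    NearUnc.iSup_kPrime_lt_top hc (hall h)⟩, fun h => ?_, fun ⟨c, hc, h⟩ =>
    NearUnc.iSup_kPrime_lt_top hc h⟩
  obtain ⟨c, hc, h⟩ := NearUnc.exists_matchingProperty h
  exact ⟨c, hc, hall h⟩
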